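/- **Setting.** For each $n\in\mathbb N$ let $N=N_n$, $T=T_n$ with $N,T\to\infty$ as $n\to\infty$, and let $K_1,K_2\ge 1$ be fixed integers. On a probability space consider the $N\times T$ matrix model $$Y=M+X\odot\Theta+U,\qquad \Theta=\Lambda F',\qquad M=AG',$$ where $\odot$ is the entrywise product, the loadings $\Lambda$ ($N\times K_1$, rows $\lambda_i'$) and $A$ ($N\times K_2$, rows $\alpha_i'$) are deterministic, and the factors $F$ ($T\times K_1$, rows $f_t'$), $G$ ($T\times K_2$, rows $g_t'$) and $X,U$ ($N\times T$) are random. Let $\|\cdot\|$, $\|\cdot\|_F$, $\|\cdot\|_n$ denote the operator, Frobenius and nuclear norms and $\psi_1(B)\ge\psi_2(B)\ge\cdots$ the singular values of a matrix $B$. For a period $t$, let $\{1,\dots,T\}\setminus\{t\}=I\cup I^c$ be a (possibly random) partition with $|I|=\lfloor (T-1)/2\rfloor$. For $S\in\{I,I^c,\{1,\dots,T\}\}$, a subscript $S$ on $Y,X,M,\Theta$ means that only the columns in $S$ are kept. **Estimators.** With (possibly random) tuning parameters $\nu_1,\nu_2>0$, let $(\widetilde M_S,\widetilde\Theta_S)$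 be a global minimizer of $\|Y_S-M-X_S\odot\Theta\|_F^2+\nu_2\|M\|_n+\nu_1\|\Theta\|_n$. Writing $\widetilde M,\widetilde\Theta$ for the full-sample solution, let $$\widehat K_1=\sum_i 1\{\psi_i(\widetilde\Theta)\ge(\nu_2\|\widetilde\Theta\|)^{1/2}\},\qquad \widehat K_2=\sum_i 1\{\psi_i(\widetilde M)\ge(\nu_1\|\widetilde M\|)^{1/2}\},$$ with $i$ running from $1$ to $\min\{N,T\}$. The columns of $\widetilde\Lambda_S$ (of $\widetilde A_S$) are $\sqrt N$ times the first $\widehat K_1$ (first $\widehat K_2$) orthonormal eigenvectors of $\widetilde\Theta_S\widetilde\Theta_S'$ (of $\widetilde M_S\widetilde M_S'$), eigenvalues in decreasing order. **Restricted strong convexity.** For an $N\times|S|$ matrix $B$ let $\mathcal P_B(\Delta)=U_cU_c'\,\Delta\,V_cV_c'$, where $U_c,V_c$ collect the left and right singular vectors of $B$ (from its full singular value decomposition) for the singular value zero, and let $\mathcal M_B(\Delta)=\Delta-\mathcal P_B(\Delta)$. For $a>0$ let $$\mathcal C_S(a)=\{(\Delta_1,\Delta_2):\ \|\mathcal P_{M_S}(\Delta_1)\|_n+\|\mathcal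 P_{\Theta_S}(\Delta_2)\|_n\le a\|\mathcal M_{M_S}(\Delta_1)\|_n+a\|\mathcal M_{\Theta_S}(\Delta_2)\|_n\}.$$ Say that RSC holds with constants $(a,\kappa)$ if, for each of the three samples $S$, with probability tending to one, $\|\Delta_1+\Delta_2\odot X_S\|_F^2\ge\kappa\|\Delta_1\|_F^2+\kappa\|\Delta_2\|_F^2$ for all $(\Delta_1,\Delta_2)\in\mathcal C_S(a)$. **Factor conditions.** (F1) There are constants $c_1>\dots>c_{K_1}>0$ and $c_1'>\dots>c_{K_2}'>0$ such that the $j$-th largest eigenvalue of $(\frac1T\sum_tf_tf_t')^{1/2}\,\frac1N\sum_i\lambda_i\lambda_i'\,(\frac1T\sum_tf_tf_t')^{1/2}$ is $c_j+o_P(1)$ for $j\le K_1$, and the $j$-th largest eigenvalue of $(\frac1T\sum_tg_tg_t')^{1/2}\,\frac1N\sum_i\alpha_i\alpha_i'\,(\frac1T\sum_tg_tg_t')^{1/2}$ is $c'_j+o_P(1)$ for $j\le K_2$. (F2) For $S\in\{I,I^c\}$, $\frac1{|S|}\sum_{t\in S}f_tf_t'=\frac1T\sum_{t=1}^Tf_tf_t'+o_P(1)$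 and $\frac1{|S|}\sum_{t\in S}g_tg_t'=\frac1T\sum_{t=1}^Tg_tg_t'+o_P(1)$; and for some constant $\delta>0$, with probability tending to one, all eigenvalues of $\frac1T\sum_{t=1}^Tf_tf_t'$ and $\frac1T\sum_{t=1}^Tg_tg_t'$ are at least $\delta$. **Proposition.** Suppose that for constants $c\in(0,1)$ and $\rho$, with probability tending to one, $$2\|X\odot U\|<(1-c)\nu_1,\qquad 2\|U\|<(1-c)\nu_2,\qquad \nu_1\le\rho\nu_2,\qquad \nu_2\le\rho\nu_1,$$ and that RSC holds with some constants $a\ge\rho(2-c)/c$ and $\kappa>0$. Then: (i) For each $S\in\{I,I^c,\{1,\dots,T\}\}$, $$\frac1{NT}\|\widetilde M_S-M_S\|_F^2=O_P\Big(\frac{\nu_2^2+\nu_1^2}{NT}\Big),\qquad \frac1{NT}\|\widetilde\Theta_S-\Theta_S\|_F^2=O_P\Big(\frac{\nu_2^2+\nu_1^2}{NT}\Big).$$ Suppose additionally that (F1) and (F2) hold and that $(\nu_1^2+\nu_2^2)/(NT)=o_P(1)$. Then: (ii) For each such $S$ there are (random) square matrices $H_{S1}$ ($K_2\times K_2$)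 and $H_{S2}$ ($K_1\times K_1$), invertible with probability tending to one, such that $$\frac1N\|\widetilde A_S-AH_{S1}\|_F^2=O_P\Big(\frac{\nu_2^2+\nu_1^2}{NT}\Big),\qquad \frac1N\|\widetilde\Lambda_S-\Lambda H_{S2}\|_F^2=O_P\Big(\frac{\nu_2^2+\nu_1^2}{NT}\Big),$$ where an error is counted as $+\infty$ if the numbers of columns differ ($\widehat K_2\ne K_2$, respectively $\widehat K_1\neq K_1$). (iii) $P(\widehat K_1=K_1,\ \widehat K_2=K_2)\to1$. -/

import Mathlib

open Matrix Filter Topology MeasureTheory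
open scoped ENNReal

noncomputable section

/-! ### Matrix norms, singular values, projections -/

/-- Squared Frobenius norm `‖A‖_F²`. -/
def frobSq {m n : Type*} [Fintype m] [Fintype n] (A : Matrix m n ℝ) : ℝ :=
  ∑ i, ∑ j, A i j ^ 2

/-- Operator (spectral) norm `‖A‖`, as an operator between Euclidean spaces. -/
def opNorm {m n : Type*} [Fintype m] [Fintype n] [DecidableEq n] (A : Matrix m n ℝ) : ℝ :=
  ‖LinearMap.toContinuousLinearMap (Matrix.toEuclideanLin A)‖

/-- Singular values in decreasing order with multiplicity, counted from zero: `sval A j` is the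
`(j+1)`-st largest singular value of `A` (and it is `0` for `j ≥ min (rows, columns)`). -/
def sval {m n : Type*} [Fintype m] [Fintype n] [DecidableEq n] (A : Matrix m n ℝ) (j : ℕ) : ℝ :=
  (Matrix.toEuclideanLin A).singularValues j

/-- Nuclear norm `‖A‖_n`, the sum of the `min (rows, columns)` singular values. -/
def nuclearNorm {m n : Type*} [Fintype m] [Fintype n] [DecidableEq n] (A : Matrix m n ℝ) : ℝ :=
  ∑ j ∈ Finset.range (min (Fintype.card m) (Fintype.card n)), sval A j

/-- The matrix of the orthogonal projection onto the kernel of `A`. The kernel of `A` is spanned by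
the right singular vectors `V_c` that belong to the singular value zero, so this is `V_c V_c'`;
`kerProj Aᵀ` is `U_c U_c'` for the left singular vectors `U_c`. -/
def kerProj {m n : Type*} [Fintype m] [Fintype n] [DecidableEq n] (A : Matrix m n ℝ) :
    Matrix n n ℝ :=
  Matrix.toEuclideanLin.symm
    ((LinearMap.ker (Matrix.toEuclideanLin A)).starProjection : _ →L[ℝ] _).toLinearMap

/-- `𝒫(Δ) = U_c U_c' Δ V_c V_c'`, where `U_c`, `V_c` are the singular vectors of `B` that belong
to the singular value zero. -/
def offProj {m n : Type*} [Fintype m] [Fintype n] [DecidableEq m] [DecidableEq n]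
    (B D : Matrix m n ℝ) : Matrix m n ℝ :=
  kerProj Bᵀ * D * kerProj B

/-- `ℳ(Δ) = Δ - 𝒫(Δ)`, the projection onto the low-rank space of `B`. -/
def lowProj {m n : Type*} [Fintype m] [Fintype n] [DecidableEq m] [DecidableEq n]
    (B D : Matrix m n ℝ) : Matrix m n ℝ :=
  D - offProj B D

/-! ### Restricted strong convexity -/

/-- Membership of `(Δ₁, Δ₂)` in the restricted low-rank set `𝒞(a)` of the pair `(M⁰, Θ⁰)`; `Δ₁` is
a direction for `M`, `Δ₂` a direction for `Θ`. -/
def InLowRankCone {m n : Type*} [Fintype m] [Fintype n] [DecidableEq m] [DecidableEq n]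
    (M0 Th0 : Matrix m n ℝ) (a : ℝ) (D1 D2 : Matrix m n ℝ) : Prop :=
  nuclearNorm (offProj M0 D1) + nuclearNorm (offProj Th0 D2) ≤
    a * nuclearNorm (lowProj M0 D1) + a * nuclearNorm (lowProj Th0 D2)

/-- Strong convexity with constant `κ` of the quadratic loss, restricted to the set `𝒞(a)`. -/
def RestrictedStrongConvexity {m n : Type*} [Fintype m] [Fintype n] [DecidableEq m]
    [DecidableEq n] (X M0 Th0 : Matrix m n ℝ) (a κ : ℝ) : Prop :=
  ∀ D1 D2 : Matrix m n ℝ, InLowRankCone M0 Th0 a D1 D2 →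
    κ * frobSq D1 + κ * frobSq D2 ≤ frobSq (D1 + D2 ⊙ X)

/-! ### The estimators -/

/-- The penalized least squares objective. -/
def penalizedLoss {m n : Type*} [Fintype m] [Fintype n] [DecidableEq n]
    (Y X : Matrix m n ℝ) (ν₁ ν₂ : ℝ) (M Th : Matrix m n ℝ) : ℝ :=
  frobSq (Y - M - X ⊙ Th) + ν₂ * nuclearNorm M + ν₁ * nuclearNorm Th

/-- `(M, Θ)` is a global minimizer of the penalized objective. -/
def IsNuclearNormEstimator {m n : Type*} [Fintype m] [Fintype n] [DecidableEq n]
    (Y X : Matrix m n ℝ) (ν₁ ν₂ : ℝ) (M Th : Matrix m n ℝ) : Prop :=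
  ∀ M' Th' : Matrix m n ℝ, penalizedLoss Y X ν₁ ν₂ M Th ≤ penalizedLoss Y X ν₁ ν₂ M' Th'

/-- The number of singular values `ψ_i(B)`, `1 ≤ i ≤ min (rows, columns)`, with
`ψ_i(B) ≥ (ν ‖B‖)^{1/2}`. -/
def rankEstimate {m n : Type*} [Fintype m] [Fintype n] [DecidableEq n]
    (ν : ℝ) (B : Matrix m n ℝ) : ℕ :=
  ((Finset.range (min (Fintype.card m) (Fintype.card n))).filter
    (fun j => Real.sqrt (ν * opNorm B) ≤ sval B j)).card

/-- The columns of `L` are `√N` times the first `k` (orthonormal) eigenvectors of `B B'`. The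
`j`-th largest eigenvalue of `B B'` is the square of the `j`-th largest singular value of `B`. -/
def IsLoadingEstimator {N k : ℕ} {n : Type*} [Fintype n] [DecidableEq n]
    (B : Matrix (Fin N) n ℝ) (L : Matrix (Fin N) (Fin k) ℝ) : Prop :=
  ∃ V : Matrix (Fin N) (Fin k) ℝ, Vᵀ * V = 1 ∧
    (∀ j : Fin k, (B * Bᵀ) *ᵥ (fun i => V i j) = (sval B j) ^ 2 • (fun i => V i j)) ∧
    L = Real.sqrt N • V

/-- `N⁻¹ ‖L̃ - L H‖_F²`. If the number `k` of columns of `L̃` differs from the number `K` of columns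
of `L`, the matrices cannot be compared and the error is set to `∞`. -/
def loadingError {N k K : ℕ} (Lt : Matrix (Fin N) (Fin k) ℝ) (L : Matrix (Fin N) (Fin K) ℝ)
    (H : Matrix (Fin K) (Fin K) ℝ) : ℝ≥0∞ :=
  if h : K = k then ENNReal.ofReal (frobSq (Lt.submatrix id (Fin.cast h) - L * H) / N) else ⊤

/-! ### Samples -/

/-- The three samples: the two subsamples and the full sample. -/
inductive SampleKind
  | first
  | second
  | full

/-- The periods in each sample, for a left out period `t` and a set `I` of periods: `I`, the
complement of `I` within the periods other than `t`, and all periods. -/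
def SampleKind.periods {T : ℕ} (t : Fin T) (I : Finset (Fin T)) : SampleKind → Finset (Fin T)
  | .first => I
  | .second => (insert t I)ᶜ
  | .full => Finset.univ

/-- The columns of `Z` that belong to the periods in `S`. -/
def onSample {N T : ℕ} (Z : Matrix (Fin N) (Fin T) ℝ) (S : Finset (Fin T)) :
    Matrix (Fin N) S ℝ :=
  Z.submatrix id Subtype.val

/-- The model `Y = A G' + X ⊙ (Λ F') + U`. -/
def outcome {N T K₁ K₂ : ℕ} (Λ : Matrix (Fin N) (Fin K₁) ℝ) (F : Matrix (Fin T) (Fin K₁) ℝ)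
    (A : Matrix (Fin N) (Fin K₂) ℝ) (G : Matrix (Fin T) (Fin K₂) ℝ)
    (X U : Matrix (Fin N) (Fin T) ℝ) : Matrix (Fin N) (Fin T) ℝ :=
  A * Gᵀ + X ⊙ (Λ * Fᵀ) + U

/-! ### Factor strength -/

/-- `|S|⁻¹ ∑_{t ∈ S} f_t f_t'`, where `f_t'` is row `t` of `F`. -/
def secondMoment {T K : ℕ} (F : Matrix (Fin T) (Fin K) ℝ) (S : Finset (Fin T)) :
    Matrix (Fin K) (Fin K) ℝ :=
  (S.card : ℝ)⁻¹ • ∑ t ∈ S, vecMulVec (F t) (F t)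

open scoped MatrixOrder in
/-- `Σ_F^{1/2} (N⁻¹ ∑_i λ_i λ_i') Σ_F^{1/2}` with `Σ_F = T⁻¹ ∑_t f_t f_t'` and the positive
semidefinite square root. -/
def strengthMatrix {N T K : ℕ} (L : Matrix (Fin N) (Fin K) ℝ) (F : Matrix (Fin T) (Fin K) ℝ) :
    Matrix (Fin K) (Fin K) ℝ :=
  CFC.sqrt (secondMoment F Finset.univ) * secondMoment L Finset.univ *
    CFC.sqrt (secondMoment F Finset.univ)

theorem secondMoment_isHermitian {T K : ℕ} (F : Matrix (Fin T) (Fin K) ℝ) (S : Finset (Fin T)) :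
    (secondMoment F S).IsHermitian := by
  ext i j
  simp [secondMoment, Matrix.sum_apply, vecMulVec_apply, mul_comm]

open scoped MatrixOrder in
theorem strengthMatrix_isHermitian {N T K : ℕ} (L : Matrix (Fin N) (Fin K) ℝ)
    (F : Matrix (Fin T) (Fin K) ℝ) : (strengthMatrix L F).IsHermitian := by
  have h : (CFC.sqrt (secondMoment F Finset.univ)).IsHermitian :=
    (CFC.sqrt_nonneg (secondMoment F Finset.univ)).posSemidef.1
  have h2 := secondMoment_isHermitian L Finset.univ
  unfold strengthMatrix
  rw [Matrix.IsHermitian, conjTranspose_mul, conjTranspose_mul, h.eq, h2.eq, Matrix.mul_assoc]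

/-- The `(j+1)`-st largest eigenvalue of the strength matrix. -/
def strengthEigenvalue {N T K : ℕ} (L : Matrix (Fin N) (Fin K) ℝ) (F : Matrix (Fin T) (Fin K) ℝ)
    (j : Fin K) : ℝ :=
  (strengthMatrix_isHermitian L F).eigenvalues₀ (Fin.cast (Fintype.card_fin K).symm j)

/-! ### Stochastic orders -/

/-- The events `p n` hold with probability tending to one (the complements have probability tending
to zero; for an event that is not measurable this refers to the outer probability). -/
def WithProbTendingToOne {Ω : Type*} [MeasurableSpace Ω] (μ : Measure Ω)
    (p : ℕ → Ω → Prop) : Prop :=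
  Tendsto (fun n => μ {ω | ¬ p n ω}) atTop (𝓝 0)

/-- `Z_n = o_P(1)`. -/
def IsLittleOPOne {Ω : Type*} [MeasurableSpace Ω] (μ : Measure Ω) (Z : ℕ → Ω → ℝ) : Prop :=
  ∀ ε : ℝ, 0 < ε → Tendsto (fun n => μ {ω | ε < |Z n ω|}) atTop (𝓝 0)

/-- `Z_n = O_P(r_n)` for nonnegative `Z_n`, which may take the value `∞`. -/
def IsBigOP {Ω : Type*} [MeasurableSpace Ω] (μ : Measure Ω) (Z : ℕ → Ω → ℝ≥0∞)
    (r : ℕ → Ω → ℝ) : Prop :=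
  ∀ ε : ℝ≥0∞, 0 < ε → ∃ C : ℝ, 0 < C ∧
    ∀ᶠ n in atTop, μ {ω | ENNReal.ofReal (C * r n ω) < Z n ω} ≤ ε

/-! ### Assumptions on the factors -/

/-- Strong factors with distinct strengths: there are constants `c_1 > ... > c_K > 0` such that the
`j`-th largest eigenvalue of the strength matrix is `c_j + o_P(1)`. -/
def StrongDistinctFactors {Ω : Type*} [MeasurableSpace Ω] (μ : Measure Ω) {N T : ℕ → ℕ} {K : ℕ}
    (L : ∀ n, Matrix (Fin (N n)) (Fin K) ℝ) (F : ∀ n, Ω → Matrix (Fin (T n)) (Fin K) ℝ) : Prop :=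
  ∃ c : Fin K → ℝ, StrictAnti c ∧ (∀ j, 0 < c j) ∧
    ∀ j, IsLittleOPOne μ (fun n ω => strengthEigenvalue (L n) (F n ω) j - c j)

/-- The factor second moments on the subsamples agree with the one on the full sample up to
`o_P(1)`, and the eigenvalues of the latter are bounded away from zero. -/
def BalancedFactors {Ω : Type*} [MeasurableSpace Ω] (μ : Measure Ω) {T : ℕ → ℕ} {K : ℕ}
    (F : ∀ n, Ω → Matrix (Fin (T n)) (Fin K) ℝ) (t : ∀ n, Fin (T n))
    (I : ∀ n, Ω → Finset (Fin (T n))) : Prop :=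
  (∀ s : SampleKind, IsLittleOPOne μ (fun n ω =>
    frobSq (secondMoment (F n ω) (s.periods (t n) (I n ω)) -
      secondMoment (F n ω) Finset.univ))) ∧
  ∃ δ : ℝ, 0 < δ ∧ WithProbTendingToOne μ (fun n ω =>
    ∀ x ∈ spectrum ℝ (secondMoment (F n ω) Finset.univ), δ ≤ x)

end

noncomputable section

/-! ### Singular values, trace duality and the nuclear norm -/

section SingularValues

variable {m n : Type*} [Fintype m] [Fintype n] [DecidableEq n]

/-! Rate: comparing the objective at the minimizer with its value at the truth bounds the squared
norm of `Δ₁ + Δ₂ ⊙ X` by score terms plus differences of nuclear norms. Trace duality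
(`frobInner_le`) lets the penalties absorb the scores, and decomposability (`nuclearNorm_sub_le`)
splits the differences into a low-rank part minus an off part. Nonnegativity of the left side puts
the error in the cone. Restricted convexity, with rank at most `2k` of the low-rank part, then
closes the bound by Cauchy–Schwarz (`frobSq_estimator_le`).

Factors: the common component has its last nonzero singular value of order `√(NT)`, also on half of
the periods, and the estimation error is of smaller order, so the estimate inherits this
(`sval_estimate_lower_bound`). The leading left singular vectors `V` of an estimate `B` of `L F'`
satisfy `V = B Z` with `Z` of squared norm `O(1/(NT))`; hence `V - L (F' Z) = (B - L F') Z` is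
small, and orthonormality of `V` forces `F' Z` to be invertible (`exists_rotation`).

Rank: the next singular value is at most the error, of order `ν` (Weyl). The threshold `√(ν‖B‖)` is
the geometric mean of the noise scale `ν` and the signal scale `√(NT)`, so it separates the two.

Each of these is a deterministic inequality on a good event. Events of probability tending to one
form a filter (`probFilter`), so no measurability is needed to combine them. -/

/-- The trace inner product `∑ᵢⱼ Wᵢⱼ Aᵢⱼ`. -/
def frobInner (W A : Matrix m n ℝ) : ℝ := (Wᵀ * A).trace

omit [DecidableEq n] in
theorem frobInner_self (A : Matrix m n ℝ) : frobInner A A = frobSq A := by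
  simp only [frobInner, frobSq, Matrix.trace, Matrix.diag, Matrix.mul_apply, transpose_apply]
  rw [Finset.sum_comm]
  simp [sq]

omit [DecidableEq n] in
theorem frobSq_nonneg (A : Matrix m n ℝ) : 0 ≤ frobSq A :=
  Finset.sum_nonneg fun _ _ => Finset.sum_nonneg fun _ _ => sq_nonneg _

theorem sval_nonneg (A : Matrix m n ℝ) (j : ℕ) : 0 ≤ sval A j :=
  LinearMap.singularValues_nonneg _ _

theorem sval_antitone (A : Matrix m n ℝ) : Antitone (sval A) :=
  LinearMap.singularValues_antitone _

theorem nuclearNorm_nonneg (A : Matrix m n ℝ) : 0 ≤ nuclearNorm A :=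
  Finset.sum_nonneg fun _ _ => sval_nonneg _ _

theorem opNorm_nonneg (A : Matrix m n ℝ) : 0 ≤ opNorm A := norm_nonneg _

theorem norm_toEuclideanLin_le (A : Matrix m n ℝ) (x : EuclideanSpace ℝ n) :
    ‖toEuclideanLin A x‖ ≤ opNorm A * ‖x‖ :=
  (LinearMap.toContinuousLinearMap (toEuclideanLin A)).le_opNorm x

theorem opNorm_le_of_forall {A : Matrix m n ℝ} {C : ℝ} (hC : 0 ≤ C)
    (h : ∀ x, ‖toEuclideanLin A x‖ ≤ C * ‖x‖) : opNorm A ≤ C :=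
  ContinuousLinearMap.opNorm_le_bound _ hC h

theorem inner_toEuclideanLin_transpose [DecidableEq m] (A : Matrix m n ℝ)
    (x : EuclideanSpace ℝ m) (y : EuclideanSpace ℝ n) :
    inner ℝ (toEuclideanLin Aᵀ x) y = inner ℝ x (toEuclideanLin A y) := by
  rw [← conjTranspose_eq_transpose_of_trivial, toEuclideanLin_conjTranspose_eq_adjoint,
    LinearMap.adjoint_inner_left]

/-- Eigenvectors of `A'A`. The orthogonality of their images replaces a full singular value
decomposition, so left singular vectors need never be chosen. -/
theorem exists_rightSingularBasis (A : Matrix m n ℝ) :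
    ∃ v : OrthonormalBasis (Fin (Fintype.card n)) ℝ (EuclideanSpace ℝ n),
      ∀ i j, inner ℝ (toEuclideanLin A (v i)) (toEuclideanLin A (v j)) =
        if i = j then sval A i ^ 2 else 0 := by
  set S := toEuclideanLin A
  have hn : Module.finrank ℝ (EuclideanSpace ℝ n) = Fintype.card n := by simp
  refine ⟨S.isSymmetric_adjoint_comp_self.eigenvectorBasis hn, fun i j => ?_⟩
  rw [← LinearMap.adjoint_inner_left, ← LinearMap.comp_apply,
    LinearMap.IsSymmetric.apply_eigenvectorBasis, inner_smul_left,
    OrthonormalBasis.inner_eq_ite, sval, S.sq_singularValues_fin hn]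
  split_ifs <;> simp

theorem sum_inner_eq_trace {ι : Type*} [Fintype ι] (W A : Matrix m n ℝ)
    (v : OrthonormalBasis ι ℝ (EuclideanSpace ℝ n)) :
    ∑ i, inner ℝ (toEuclideanLin W (v i)) (toEuclideanLin A (v i)) =
      LinearMap.trace ℝ _ (LinearMap.adjoint (toEuclideanLin W) ∘ₗ toEuclideanLin A) := by
  classical
  rw [LinearMap.trace_eq_sum_inner _ v]
  simp [LinearMap.adjoint_inner_right]

/-- A trace does not depend on the orthonormal basis; the point is to use the right singular basis
of one of the matrices. -/
theorem frobInner_eq_sum_inner {ι : Type*} [Fintype ι] (W A : Matrix m n ℝ)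
    (v : OrthonormalBasis ι ℝ (EuclideanSpace ℝ n)) :
    frobInner W A = ∑ i, inner ℝ (toEuclideanLin W (v i)) (toEuclideanLin A (v i)) := by
  rw [sum_inner_eq_trace W A v, ← sum_inner_eq_trace W A (EuclideanSpace.basisFun n ℝ)]
  simp [frobInner, Matrix.trace, Matrix.mul_apply, PiLp.inner_apply, toLpLin_apply, mul_comm]

theorem norm_toEuclideanLin_singular {A : Matrix m n ℝ}
    {v : OrthonormalBasis (Fin (Fintype.card n)) ℝ (EuclideanSpace ℝ n)}
    (hv : ∀ i j, inner ℝ (toEuclideanLin A (v i)) (toEuclideanLin A (v j)) =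
        if i = j then sval A i ^ 2 else 0) (i) : ‖toEuclideanLin A (v i)‖ = sval A i := by
  have := hv i i
  rw [real_inner_self_eq_norm_sq, if_pos rfl] at this
  exact (sq_eq_sq₀ (norm_nonneg _) (sval_nonneg _ _)).1 this

theorem frobSq_eq_sum_sval_sq (A : Matrix m n ℝ) :
    frobSq A = ∑ i : Fin (Fintype.card n), sval A i ^ 2 := by
  obtain ⟨v, hv⟩ := exists_rightSingularBasis A
  rw [← frobInner_self, frobInner_eq_sum_inner A A v]
  exact Finset.sum_congr rfl fun i _ => by rw [hv, if_pos rfl]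

theorem sval_eq_zero_of_rank_le {A : Matrix m n ℝ} {j : ℕ} (h : A.rank ≤ j) : sval A j = 0 := by
  rw [sval, LinearMap.singularValues_eq_zero_iff_le_finrank_range]
  rwa [Matrix.rank_eq_finrank_range_toLin A (PiLp.basisFun 2 ℝ m) (PiLp.basisFun 2 ℝ n),
    ← Matrix.toLpLin_eq_toLin] at h

/-- Padding with zero singular values makes the index set that of the singular basis. -/
theorem nuclearNorm_eq_sum_fin (A : Matrix m n ℝ) :
    nuclearNorm A = ∑ i : Fin (Fintype.card n), sval A i := by
  rw [Fin.sum_univ_eq_sum_range (fun i => sval A i), nuclearNorm]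
  apply Finset.sum_subset
  · intro i; simp
  · intro i hi hi'
    simp only [Finset.mem_range, not_lt, lt_inf_iff, not_and_or] at hi hi'
    apply sval_eq_zero_of_rank_le
    rcases hi' with h | h
    · exact (Matrix.rank_le_card_height A).trans h
    · omega

theorem nuclearNorm_sq_le (A : Matrix m n ℝ) {r : ℕ} (h : A.rank ≤ r) :
    nuclearNorm A ^ 2 ≤ r * frobSq A := by
  -- Singular values from index `r` on vanish. The condition `i < card n` keeps the indices inside
  -- the Frobenius sum, since `r` may exceed the number of columns.
  have h1 : nuclearNorm A = ∑ i ∈ Finset.range r with i < Fintype.card n, sval A i := by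
    rw [nuclearNorm_eq_sum_fin, Fin.sum_univ_eq_sum_range (fun i => sval A i)]
    symm
    apply Finset.sum_subset
    · intro i; simp
    · intro i hi hi'
      apply sval_eq_zero_of_rank_le
      simp at hi hi'
      by_contra h'
      exact absurd (hi' (by omega)) (by omega)
  have h2 : ∑ i ∈ Finset.range r with i < Fintype.card n, sval A i ^ 2 ≤ frobSq A := by
    rw [frobSq_eq_sum_sval_sq, Fin.sum_univ_eq_sum_range (fun i => sval A i ^ 2)]
    apply Finset.sum_le_sum_of_subset_of_nonneg
    · intro i; simp
    · intros; positivity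
  rw [h1]
  refine (sq_sum_le_card_mul_sum_sq).trans ?_
  have h3 : (({i ∈ Finset.range r | i < Fintype.card n}.card : ℕ) : ℝ) ≤ r := by
    exact_mod_cast (Finset.card_filter_le _ _).trans (by simp)
  exact mul_le_mul h3 h2 (Finset.sum_nonneg fun _ _ => sq_nonneg _) (by positivity)

/-- In the right singular basis of `A`, each term is at most `‖W vᵢ‖ ‖A vᵢ‖ ≤ ‖W‖ σᵢ`. -/
theorem frobInner_le (W A : Matrix m n ℝ) : frobInner W A ≤ opNorm W * nuclearNorm A := by
  obtain ⟨v, hv⟩ := exists_rightSingularBasis A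
  rw [frobInner_eq_sum_inner W A v, nuclearNorm_eq_sum_fin, Finset.mul_sum]
  refine Finset.sum_le_sum fun i _ => ?_
  refine (real_inner_le_norm _ _).trans ?_
  rw [norm_toEuclideanLin_singular hv]
  have := norm_toEuclideanLin_le W (v i)
  rw [v.norm_eq_one, mul_one] at this
  exact mul_le_mul_of_nonneg_right this (sval_nonneg _ _)

theorem exists_dual_certificate (A : Matrix m n ℝ) :
    ∃ W : Matrix m n ℝ, opNorm W ≤ 1 ∧ frobInner W A = nuclearNorm A := by
  obtain ⟨v, hv⟩ := exists_rightSingularBasis A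
  -- The partial isometry of the polar decomposition. As `0⁻¹ = 0`, singular vectors for the value
  -- zero are sent to `0`.
  let f : EuclideanSpace ℝ n →ₗ[ℝ] EuclideanSpace ℝ m :=
    v.toBasis.constr ℝ fun i => (sval A i)⁻¹ • toEuclideanLin A (v i)
  have hf : ∀ i, f (v i) = (sval A i)⁻¹ • toEuclideanLin A (v i) := fun i => by
    have := v.toBasis.constr_basis ℝ (fun i => (sval A i)⁻¹ • toEuclideanLin A (v i)) i
    rwa [v.coe_toBasis] at this
  have hW : toEuclideanLin (toEuclideanLin.symm f : Matrix m n ℝ) = f :=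
    LinearEquiv.apply_symm_apply _ _
  refine ⟨toEuclideanLin.symm f, opNorm_le_of_forall zero_le_one fun x => ?_, ?_⟩
  · rw [hW, one_mul]
    refine le_of_sq_le_sq ?_ (norm_nonneg _)
    have hx : f x = ∑ i, inner ℝ (v i) x • f (v i) := by
      conv_lhs => rw [← v.sum_repr' x]
      simp
    have : ‖f x‖ ^ 2 = ∑ i, inner ℝ (v i) x ^ 2 * ((sval A i)⁻¹ * sval A i) ^ 2 := by
      rw [← real_inner_self_eq_norm_sq, hx, sum_inner]
      refine Finset.sum_congr rfl fun i _ => ?_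
      simp only [inner_sum, inner_smul_left, inner_smul_right, hf, hv]
      simp only [mul_ite, mul_zero, Finset.sum_ite_eq, Finset.mem_univ, if_true]
      simp
      ring
    rw [this, ← v.sum_sq_norm_inner_right x]
    refine Finset.sum_le_sum fun i _ => ?_
    rw [Real.norm_eq_abs, sq_abs]
    by_cases h : sval A i = 0
    · simp [h]; positivity
    · simp [h]
  · rw [frobInner_eq_sum_inner _ A v, nuclearNorm_eq_sum_fin, hW]
    refine Finset.sum_congr rfl fun i _ => ?_
    rw [hf, inner_smul_left, hv, if_pos rfl]
    by_cases h : sval A i = 0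
    · simp [h]
    · simp; field_simp

omit [DecidableEq n] in
theorem frobInner_add_right (W A B : Matrix m n ℝ) :
    frobInner W (A + B) = frobInner W A + frobInner W B := by
  simp [frobInner, Matrix.mul_add]

omit [DecidableEq n] in
theorem frobInner_neg_right (W A : Matrix m n ℝ) : frobInner W (-A) = -frobInner W A := by
  simp [frobInner]

omit [DecidableEq n] in
theorem frobInner_neg_left (W A : Matrix m n ℝ) : frobInner (-W) A = -frobInner W A := by
  simp [frobInner]

omit [DecidableEq n] in
theorem frobInner_comm (W A : Matrix m n ℝ) : frobInner W A = frobInner A W := by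
  rw [frobInner, frobInner, ← Matrix.trace_transpose]
  simp

omit [DecidableEq n] in
theorem frobInner_add_left (W A B : Matrix m n ℝ) :
    frobInner (A + B) W = frobInner A W + frobInner B W := by
  simp [frobInner, Matrix.add_mul]

theorem opNorm_neg (A : Matrix m n ℝ) : opNorm (-A) = opNorm A := by
  simp [opNorm]

theorem nuclearNorm_add_le (A B : Matrix m n ℝ) :
    nuclearNorm (A + B) ≤ nuclearNorm A + nuclearNorm B := by
  obtain ⟨W, hW, h⟩ := exists_dual_certificate (A + B)
  rw [← h, frobInner_add_right]
  have h1 := (frobInner_le W A).trans (mul_le_of_le_one_left (nuclearNorm_nonneg A) hW)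
  have h2 := (frobInner_le W B).trans (mul_le_of_le_one_left (nuclearNorm_nonneg B) hW)
  linarith

theorem nuclearNorm_neg (A : Matrix m n ℝ) : nuclearNorm (-A) = nuclearNorm A := by
  have key : ∀ B : Matrix m n ℝ, nuclearNorm (-B) ≤ nuclearNorm B := fun B => by
    obtain ⟨W, hW, h⟩ := exists_dual_certificate (-B)
    rw [← h, frobInner_neg_right, ← frobInner_neg_left]
    refine (frobInner_le _ B).trans ?_
    rw [opNorm_neg]
    exact mul_le_of_le_one_left (nuclearNorm_nonneg B) hW
  refine (key A).antisymm ?_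
  simpa using key (-A)

theorem sval_le_opNorm (A : Matrix m n ℝ) (j : ℕ) : sval A j ≤ opNorm A := by
  by_cases hj : j < Fintype.card n
  · obtain ⟨v, hv⟩ := exists_rightSingularBasis A
    have := norm_toEuclideanLin_le A (v ⟨j, hj⟩)
    rwa [norm_toEuclideanLin_singular hv, v.norm_eq_one, mul_one] at this
  · rw [sval_eq_zero_of_rank_le ((Matrix.rank_le_card_width A).trans (not_lt.1 hj))]
    exact opNorm_nonneg _

theorem opNorm_sq_le_frobSq (A : Matrix m n ℝ) : opNorm A ^ 2 ≤ frobSq A := by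
  have h : opNorm A ≤ √(frobSq A) := by
    refine opNorm_le_of_forall (Real.sqrt_nonneg _) fun x => ?_
    refine le_of_sq_le_sq ?_ (by positivity)
    rw [mul_pow, Real.sq_sqrt (frobSq_nonneg A), EuclideanSpace.norm_sq_eq,
      EuclideanSpace.norm_sq_eq, frobSq, Finset.sum_mul]
    refine Finset.sum_le_sum fun i _ => ?_
    simp only [toLpLin_apply, Real.norm_eq_abs, sq_abs, mulVec, dotProduct]
    exact Finset.sum_mul_sq_le_sq_mul_sq _ _ _
  calc opNorm A ^ 2 ≤ √(frobSq A) ^ 2 := by gcongr; exact opNorm_nonneg A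
    _ = frobSq A := Real.sq_sqrt (frobSq_nonneg A)

/-! ### Variational bounds for singular values -/

/-- Weyl's inequality for a perturbation of a matrix of rank at most `k`. -/
theorem sval_le_opNorm_sub {A B : Matrix m n ℝ} {k : ℕ} (hB : B.rank ≤ k) :
    sval A k ≤ opNorm (A - B) := by
  by_cases hk : k < Fintype.card n
  swap
  · rw [sval_eq_zero_of_rank_le ((Matrix.rank_le_card_width A).trans (not_lt.1 hk))]
    exact opNorm_nonneg _
  obtain ⟨v, hv⟩ := exists_rightSingularBasis A
  let e : Fin (k + 1) → Fin (Fintype.card n) := Fin.castLE hk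
  have he : Function.Injective e := Fin.castLE_injective hk
  let g : (Fin (k + 1) → ℝ) →ₗ[ℝ] EuclideanSpace ℝ m :=
    toEuclideanLin B ∘ₗ Fintype.linearCombination ℝ (fun i => v (e i))
  -- The first `k + 1` right singular vectors of `A` span more dimensions than the rank of `B`, so
  -- `B` kills a nonzero vector of the span, on which `A` stretches by at least `sval A k`.
  have hg : ∃ c, c ≠ 0 ∧ g c = 0 := by
    by_contra! h
    have hinj : Function.Injective g := (injective_iff_map_eq_zero g).2 fun c hc => by
      by_contra h'; exact h c h' hc
    have h1 := LinearMap.finrank_range_of_inj hinj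
    have h2 : Module.finrank ℝ g.range ≤ Module.finrank ℝ (toEuclideanLin B).range :=
      Submodule.finrank_mono (LinearMap.range_comp_le_range _ _)
    rw [Matrix.rank_eq_finrank_range_toLin B (PiLp.basisFun 2 ℝ m) (PiLp.basisFun 2 ℝ n),
      ← Matrix.toLpLin_eq_toLin] at hB
    rw [Module.finrank_fin_fun] at h1
    exact absurd (h1 ▸ h2.trans hB) (by omega)
  obtain ⟨c, hc0, hc⟩ := hg
  set x := Fintype.linearCombination ℝ (fun i => v (e i)) c with hx
  have hxs : x = ∑ i, c i • v (e i) := by simp [hx, Fintype.linearCombination_apply]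
  have horth : Orthonormal ℝ (fun i => v (e i)) := v.orthonormal.comp e he
  have hnx : ‖x‖ ^ 2 = ∑ i, c i ^ 2 := by
    rw [← real_inner_self_eq_norm_sq, hxs, horth.inner_sum]
    simp [sq]
  have hnA : ‖toEuclideanLin A x‖ ^ 2 = ∑ i, c i ^ 2 * sval A i ^ 2 := by
    rw [← real_inner_self_eq_norm_sq, hxs, map_sum, sum_inner]
    refine Finset.sum_congr rfl fun i _ => ?_
    simp only [inner_sum, map_smul, inner_smul_left, inner_smul_right, hv, he.eq_iff]
    simp [e]
    ring
  have hlow : (sval A k * ‖x‖) ^ 2 ≤ ‖toEuclideanLin A x‖ ^ 2 := by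
    rw [mul_pow, hnx, hnA, Finset.mul_sum]
    refine Finset.sum_le_sum fun i _ => ?_
    rw [mul_comm]
    have := sval_antitone A (Nat.le_of_lt_succ i.2)
    have := sval_nonneg A k
    gcongr
  have hxpos : 0 < ‖x‖ := by
    rw [norm_pos_iff]
    intro h0
    apply hc0
    rw [h0] at hnx
    simp at hnx
    rw [eq_comm, Finset.sum_eq_zero_iff_of_nonneg (fun _ _ => sq_nonneg _)] at hnx
    ext i
    simpa using hnx i (Finset.mem_univ i)
  have h3 : toEuclideanLin (A - B) x = toEuclideanLin A x := by
    have : toEuclideanLin B x = 0 := hc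
    simp [this]
  have h4 := norm_toEuclideanLin_le (A - B) x
  rw [h3] at h4
  have h5 := (le_of_sq_le_sq hlow (norm_nonneg _)).trans h4
  exact le_of_mul_le_mul_right h5 hxpos

/-- Courant–Fischer lower bound for a singular value, on a subspace parametrized by `P`. -/
theorem le_sval_of_forall_le [DecidableEq m] {B : Matrix m n ℝ} {k : ℕ} {σ : ℝ}
    (P : EuclideanSpace ℝ (Fin (k + 1)) →ₗ[ℝ] EuclideanSpace ℝ m)
    (hP : Function.Injective P) (hσ : 0 < σ)
    (h : ∀ z, σ * ‖P z‖ ≤ ‖toEuclideanLin Bᵀ (P z)‖) : σ ≤ sval B k := by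
  obtain ⟨v, hv⟩ := exists_rightSingularBasis B
  -- The `k` conditions that `B' (P z)` be orthogonal to the first `k` right singular vectors; on `k
  -- + 1` dimensions they have a nonzero solution. The zero branch covers `k > card n`.
  let g : EuclideanSpace ℝ (Fin (k + 1)) →ₗ[ℝ] (Fin k → ℝ) := LinearMap.pi fun i =>
    if hi : (i : ℕ) < Fintype.card n then
      (innerSL ℝ (v ⟨i, hi⟩)).toLinearMap ∘ₗ toEuclideanLin Bᵀ ∘ₗ P else 0
  have hg : ∃ c, c ≠ 0 ∧ g c = 0 := by
    by_contra! h
    have hinj : Function.Injective g := (injective_iff_map_eq_zero g).2 fun c hc => by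
      by_contra h'; exact h c h' hc
    have h1 := LinearMap.finrank_le_finrank_of_injective hinj
    simp at h1
  obtain ⟨z, hz0, hz⟩ := hg
  set y := toEuclideanLin Bᵀ (P z) with hy
  have hyv : ∀ i : Fin (Fintype.card n), (i : ℕ) < k → inner ℝ (v i) y = 0 := by
    intro i hi
    have := congrFun hz ⟨i, hi⟩
    simpa [g] using this
  have hys : ‖y‖ ^ 2 = ∑ i, inner ℝ (v i) y ^ 2 := by
    rw [← v.sum_sq_norm_inner_right y]; simp
  have hB : ‖toEuclideanLin B y‖ ^ 2 = ∑ i, inner ℝ (v i) y ^ 2 * sval B i ^ 2 := by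
    rw [← real_inner_self_eq_norm_sq]
    conv_lhs => rw [← v.sum_repr' y]
    rw [map_sum, sum_inner]
    refine Finset.sum_congr rfl fun i _ => ?_
    simp only [inner_sum, map_smul, inner_smul_left, inner_smul_right, hv]
    simp
    ring
  have hBy : ‖toEuclideanLin B y‖ ≤ sval B k * ‖y‖ := by
    refine le_of_sq_le_sq ?_ (mul_nonneg (sval_nonneg _ _) (norm_nonneg _))
    rw [hB, mul_pow, hys, Finset.mul_sum]
    refine Finset.sum_le_sum fun i _ => ?_
    by_cases hi : (i : ℕ) < k
    · simp [hyv i hi]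
    · rw [mul_comm]
      have := sval_antitone B (not_lt.1 hi)
      have := sval_nonneg B i
      gcongr
  have hPz : 0 < ‖P z‖ := by
    rw [norm_pos_iff]
    exact fun h0 => hz0 (hP (h0.trans (map_zero P).symm))
  have hle := h z
  rw [← hy] at hle
  have hyp : 0 < ‖y‖ := lt_of_lt_of_le (by positivity) hle
  -- `‖y‖² = ⟨P z, B y⟩`, and `B` stretches `y` by at most `sval B k`; combined with `σ ‖P z‖ ≤ ‖y‖`
  -- this gives the claim.
  have h6 : ‖y‖ ^ 2 ≤ ‖P z‖ * (sval B k * ‖y‖) := by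
    rw [← real_inner_self_eq_norm_sq]
    conv_lhs => rw [hy, inner_toEuclideanLin_transpose]
    exact (real_inner_le_norm _ _).trans (mul_le_mul_of_nonneg_left hBy (norm_nonneg _))
  have h7 : ‖y‖ ≤ ‖P z‖ * sval B k := by nlinarith
  nlinarith

end SingularValues

/-! ### The projections and decomposability of the nuclear norm -/

section Projections

variable {m n : Type*} [Fintype m] [Fintype n] [DecidableEq m] [DecidableEq n]

omit [DecidableEq m] in
theorem toEuclideanLin_kerProj_apply (A : Matrix m n ℝ) (x : EuclideanSpace ℝ n) :
    toEuclideanLin (kerProj A) x = (LinearMap.ker (toEuclideanLin A)).starProjection x := by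
  rw [kerProj, LinearEquiv.apply_symm_apply]
  rfl

omit [DecidableEq m] in
theorem mul_kerProj (A : Matrix m n ℝ) : A * kerProj A = 0 := by
  apply toEuclideanLin.injective
  rw [toLpLin_mul 2 2 2, map_zero]
  ext1 x
  rw [LinearMap.comp_apply, toEuclideanLin_kerProj_apply]
  exact (LinearMap.ker (toEuclideanLin A)).starProjection_apply_mem x

omit [DecidableEq m] in
theorem kerProj_mul_self (A : Matrix m n ℝ) : kerProj A * kerProj A = kerProj A := by
  apply toEuclideanLin.injective
  rw [toLpLin_mul 2 2 2]
  ext1 x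
  rw [LinearMap.comp_apply, toEuclideanLin_kerProj_apply, toEuclideanLin_kerProj_apply,
    Submodule.starProjection_eq_self_iff]
  exact Submodule.starProjection_apply_mem _ x

omit [DecidableEq m] in
theorem kerProj_transpose (A : Matrix m n ℝ) : (kerProj A)ᵀ = kerProj A := by
  apply toEuclideanLin.injective
  ext1 x
  refine ext_inner_right ℝ fun y => ?_
  rw [inner_toEuclideanLin_transpose, toEuclideanLin_kerProj_apply, toEuclideanLin_kerProj_apply,
    Submodule.inner_starProjection_left_eq_right]

omit [DecidableEq n] in
theorem kerProj_transpose_mul (A : Matrix m n ℝ) : kerProj Aᵀ * A = 0 := by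
  have h := congrArg Matrix.transpose (mul_kerProj Aᵀ)
  rwa [transpose_mul, transpose_transpose, kerProj_transpose, transpose_zero] at h

-- `1 - kerProj A` vanishes on the kernel of `A`, so rank–nullity compares the ranks.
omit [DecidableEq m] in
theorem rank_one_sub_kerProj_le (A : Matrix m n ℝ) : (1 - kerProj A).rank ≤ A.rank := by
  rw [Matrix.rank_eq_finrank_range_toLin A (PiLp.basisFun 2 ℝ m) (PiLp.basisFun 2 ℝ n),
    Matrix.rank_eq_finrank_range_toLin (1 - kerProj A) (PiLp.basisFun 2 ℝ n)
      (PiLp.basisFun 2 ℝ n), ← Matrix.toLpLin_eq_toLin, ← Matrix.toLpLin_eq_toLin]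
  have h1 := LinearMap.finrank_range_add_finrank_ker (toEuclideanLin A)
  have h2 := LinearMap.finrank_range_add_finrank_ker (toEuclideanLin (1 - kerProj A))
  have h3 : LinearMap.ker (toEuclideanLin A) ≤
      LinearMap.ker (toEuclideanLin (1 - kerProj A)) := by
    intro x hx
    rw [LinearMap.mem_ker, map_sub, LinearMap.sub_apply, toEuclideanLin_kerProj_apply,
      Submodule.starProjection_eq_self_iff.2 hx]
    simp
  have h4 := Submodule.finrank_mono h3
  change Module.finrank ℝ (toEuclideanLin (1 - kerProj A)).range ≤
    Module.finrank ℝ (toEuclideanLin A).range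
  omega

omit [Fintype m] [DecidableEq m] [DecidableEq n] in
theorem Matrix.rank_add_le_rank_add_rank (A B : Matrix m n ℝ) :
    (A + B).rank ≤ A.rank + B.rank := by
  simp only [Matrix.rank]
  refine (Submodule.finrank_mono ?_).trans (Submodule.finrank_add_le_finrank_add_finrank _ _)
  rintro _ ⟨x, rfl⟩
  rw [Matrix.mulVecLin_apply, Matrix.add_mulVec]
  exact Submodule.add_mem_sup ⟨x, rfl⟩ ⟨x, rfl⟩

theorem rank_lowProj_le {B : Matrix m n ℝ} {k : ℕ} (hB : B.rank ≤ k) (D : Matrix m n ℝ) :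
    (lowProj B D).rank ≤ 2 * k := by
  -- `D - PDQ = (1 - P)D + PD(1 - Q)`, and each summand has rank at most that of `B`; hence the
  -- factor two.
  have h : lowProj B D =
      (1 - kerProj Bᵀ) * D + (kerProj Bᵀ * D) * (1 - kerProj B) := by
    rw [lowProj, offProj]
    simp only [Matrix.sub_mul, Matrix.mul_sub, Matrix.one_mul, Matrix.mul_one]
    abel
  rw [h]
  refine (Matrix.rank_add_le_rank_add_rank _ _).trans ?_
  have h1 := (Matrix.rank_mul_le_left (1 - kerProj Bᵀ) D).trans (rank_one_sub_kerProj_le Bᵀ)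
  have h2 := (Matrix.rank_mul_le_right (kerProj Bᵀ * D) (1 - kerProj B)).trans
    (rank_one_sub_kerProj_le B)
  rw [Matrix.rank_transpose] at h1
  omega

omit [DecidableEq m] [DecidableEq n] in
theorem frobInner_mul_left_right {p q : Type*} [Fintype p] [Fintype q]
    (P : Matrix m p ℝ) (W : Matrix p q ℝ) (Q : Matrix q n ℝ) (A : Matrix m n ℝ) :
    frobInner (P * W * Q) A = frobInner W (Pᵀ * A * Qᵀ) := by
  simp only [frobInner, transpose_mul]
  rw [Matrix.mul_assoc, Matrix.mul_assoc, Matrix.trace_mul_comm]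
  simp only [Matrix.mul_assoc]

omit [DecidableEq m] in
theorem norm_sq_eq_add_of_symm_idem {Q : Matrix n n ℝ} (hQ : Qᵀ = Q) (hQ2 : Q * Q = Q)
    (x y : EuclideanSpace ℝ n) :
    ‖toEuclideanLin (1 - Q) x + toEuclideanLin Q y‖ ^ 2 =
      ‖toEuclideanLin (1 - Q) x‖ ^ 2 + ‖toEuclideanLin Q y‖ ^ 2 := by
  rw [norm_add_sq_real]
  have : inner ℝ (toEuclideanLin (1 - Q) x) (toEuclideanLin Q y) = 0 := by
    conv_lhs => rw [real_inner_comm]; arg 2; rw [← hQ]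
    rw [inner_toEuclideanLin_transpose, ← LinearMap.comp_apply, ← toLpLin_mul 2 2 2,
      Matrix.mul_sub, hQ2, Matrix.mul_one, sub_self]
    simp
  rw [this]; ring

omit [DecidableEq m] in
theorem norm_toEuclideanLin_le_of_symm_idem {Q : Matrix n n ℝ} (hQ : Qᵀ = Q) (hQ2 : Q * Q = Q)
    (x : EuclideanSpace ℝ n) :
    ‖toEuclideanLin (1 - Q) x‖ ≤ ‖x‖ ∧ ‖toEuclideanLin Q x‖ ≤ ‖x‖ := by
  have h := norm_sq_eq_add_of_symm_idem hQ hQ2 x x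
  have : toEuclideanLin (1 - Q) x + toEuclideanLin Q x = x := by simp
  rw [this] at h
  constructor <;> refine le_of_sq_le_sq ?_ (norm_nonneg _) <;> nlinarith [norm_nonneg x,
    sq_nonneg ‖toEuclideanLin (1 - Q) x‖, sq_nonneg ‖toEuclideanLin Q x‖]

/-- Decomposability: `B` and the off part have orthogonal row spaces and orthogonal column spaces,
so their dual certificates can be glued into one for the sum. -/
theorem nuclearNorm_add_offProj_ge (B D : Matrix m n ℝ) :
    nuclearNorm B + nuclearNorm (offProj B D) ≤ nuclearNorm (B + offProj B D) := by
  obtain ⟨W₁, hW₁, h₁⟩ := exists_dual_certificate B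
  obtain ⟨W₂, hW₂, h₂⟩ := exists_dual_certificate (offProj B D)
  set P := kerProj Bᵀ with hP
  set Q := kerProj B with hQ
  have hPt : Pᵀ = P := kerProj_transpose _
  have hQt : Qᵀ = Q := kerProj_transpose _
  have hPP : P * P = P := kerProj_mul_self _
  have hQQ : Q * Q = Q := kerProj_mul_self _
  have hPB : P * B = 0 := kerProj_transpose_mul _
  have hBQ : B * Q = 0 := mul_kerProj _
  set E := offProj B D with hE
  have hE' : E = P * D * Q := rfl
  have hPE : P * E = E := by rw [hE', ← Matrix.mul_assoc, ← Matrix.mul_assoc, hPP]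
  have hEQ : E * Q = E := by rw [hE', Matrix.mul_assoc, hQQ]
  -- Block-diagonal gluing; Pythagoras on the input and the output side keeps the operator norm at
  -- most one.
  let W := (1 - P) * W₁ * (1 - Q) + P * W₂ * Q
  have hW : opNorm W ≤ 1 := by
    refine opNorm_le_of_forall zero_le_one fun x => ?_
    rw [one_mul]
    refine le_of_sq_le_sq ?_ (norm_nonneg _)
    have hWx : toEuclideanLin W x =
        toEuclideanLin (1 - P) (toEuclideanLin W₁ (toEuclideanLin (1 - Q) x)) +
          toEuclideanLin P (toEuclideanLin W₂ (toEuclideanLin Q x)) := by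
      simp only [W, map_add, LinearMap.add_apply, toLpLin_mul 2 2 2, LinearMap.comp_apply]
    have hx : x = toEuclideanLin (1 - Q) x + toEuclideanLin Q x := by simp
    conv_rhs => rw [hx]
    rw [hWx, norm_sq_eq_add_of_symm_idem hPt hPP, norm_sq_eq_add_of_symm_idem hQt hQQ]
    have hle : ∀ (V : Matrix m n ℝ), opNorm V ≤ 1 → ∀ y, ‖toEuclideanLin V y‖ ≤ ‖y‖ :=
      fun V hV y => (norm_toEuclideanLin_le V y).trans
        (mul_le_of_le_one_left (norm_nonneg _) hV)
    have e1 := (norm_toEuclideanLin_le_of_symm_idem hPt hPP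
      (toEuclideanLin W₁ (toEuclideanLin (1 - Q) x))).1.trans (hle W₁ hW₁ _)
    have e2 := (norm_toEuclideanLin_le_of_symm_idem hPt hPP
      (toEuclideanLin W₂ (toEuclideanLin Q x))).2.trans (hle W₂ hW₂ _)
    gcongr
  have h3 : (1 - P)ᵀ * (B + E) * (1 - Q)ᵀ = B := by
    simp only [transpose_sub, transpose_one, hPt, hQt, Matrix.mul_add, Matrix.sub_mul,
      Matrix.one_mul, hPB, hPE, Matrix.mul_sub, Matrix.mul_one]
    simp [hBQ]
  have h4 : Pᵀ * (B + E) * Qᵀ = E := by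
    rw [hPt, hQt, Matrix.mul_add, hPB, hPE, zero_add, hEQ]
  have h5 := (frobInner_le W (B + E)).trans
    (mul_le_of_le_one_left (nuclearNorm_nonneg _) hW)
  rw [frobInner_add_left, frobInner_mul_left_right, frobInner_mul_left_right, h3, h4, h₁, h₂]
    at h5
  exact h5

/-- Removing the low part from `B + D` leaves `B + offProj B D`, to which decomposability applies.
-/
theorem nuclearNorm_sub_le (B D : Matrix m n ℝ) :
    nuclearNorm B - nuclearNorm (B + D) ≤
      nuclearNorm (lowProj B D) - nuclearNorm (offProj B D) := by
  have h1 := nuclearNorm_add_offProj_ge B D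
  have h2 := nuclearNorm_add_le (B + D) (-lowProj B D)
  rw [nuclearNorm_neg] at h2
  have h3 : B + D + -lowProj B D = B + offProj B D := by rw [lowProj]; abel
  rw [h3] at h2
  linarith

theorem nuclearNorm_le_low_add_off (B D : Matrix m n ℝ) :
    nuclearNorm D ≤ nuclearNorm (lowProj B D) + nuclearNorm (offProj B D) := by
  have h := nuclearNorm_add_le (lowProj B D) (offProj B D)
  rwa [lowProj, sub_add_cancel] at h

/-! ### The basic inequality and the rate of the estimator -/

omit [DecidableEq m] [DecidableEq n] in
theorem frobSq_add (A B : Matrix m n ℝ) :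
    frobSq (A + B) = frobSq A + 2 * frobInner A B + frobSq B := by
  rw [← frobInner_self, ← frobInner_self, ← frobInner_self, frobInner_add_right,
    frobInner_add_left, frobInner_add_left, frobInner_comm B A]
  ring

omit [DecidableEq m] [DecidableEq n] in
theorem frobInner_eq_sum (A B : Matrix m n ℝ) :
    frobInner A B = ∑ i, ∑ j, A i j * B i j := by
  rw [Finset.sum_comm]
  simp [frobInner, Matrix.trace, Matrix.mul_apply]

-- Moves the regressor from the direction onto the error, which produces the score `X ⊙ U`.
omit [DecidableEq m] [DecidableEq n] in
theorem frobInner_hadamard (A B C : Matrix m n ℝ) :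
    frobInner A (B ⊙ C) = frobInner (B ⊙ A) C := by
  simp [frobInner_eq_sum, hadamard_apply, mul_comm, mul_left_comm]

theorem frobSq_lowProj_le (B D : Matrix m n ℝ) : frobSq (lowProj B D) ≤ frobSq D := by
  have h : D = lowProj B D + offProj B D := by rw [lowProj, sub_add_cancel]
  have h0 : frobInner (lowProj B D) (offProj B D) = 0 := by
    rw [frobInner_comm]
    nth_rw 1 [offProj]
    rw [frobInner_mul_left_right, kerProj_transpose, kerProj_transpose]
    have : kerProj Bᵀ * lowProj B D * kerProj B = 0 := by
      rw [lowProj, offProj, Matrix.mul_sub, Matrix.sub_mul]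
      have e : kerProj Bᵀ * (kerProj Bᵀ * D * kerProj B) * kerProj B =
          (kerProj Bᵀ * kerProj Bᵀ) * D * (kerProj B * kerProj B) := by
        simp only [Matrix.mul_assoc]
      rw [e, kerProj_mul_self, kerProj_mul_self, sub_self]
    rw [this]
    simp [frobInner]
  have h2 := frobSq_add (lowProj B D) (offProj B D)
  rw [← h, h0] at h2
  linarith [frobSq_nonneg (offProj B D)]

/-- Squaring the hypothesis and dividing by `f` gives the constant `8k`; `16k` leaves slack. -/
theorem le_of_mul_le_cauchySchwarz {κ f p q x y k : ℝ} (hκ : 0 < κ) (hk : 0 ≤ k) (hf : 0 ≤ f)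
    (h : κ * f ≤ 2 * (p * x + q * y)) (hxy : x ^ 2 + y ^ 2 ≤ 2 * k * f) :
    f ≤ 16 * k / κ ^ 2 * (p ^ 2 + q ^ 2) := by
  have u2 : (p * x + q * y) ^ 2 ≤ (p ^ 2 + q ^ 2) * (x ^ 2 + y ^ 2) := by
    nlinarith [sq_nonneg (p * y - q * x)]
  have h1 : (κ * f) ^ 2 ≤ (2 * (p * x + q * y)) ^ 2 :=
    pow_le_pow_left₀ (mul_nonneg hκ.le hf) h 2
  have h2 : (p ^ 2 + q ^ 2) * (x ^ 2 + y ^ 2) ≤ (p ^ 2 + q ^ 2) * (2 * k * f) :=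
    mul_le_mul_of_nonneg_left hxy (by positivity)
  rcases hf.eq_or_lt with h0 | h0
  · rw [← h0]
    positivity
  · have hk' : 0 ≤ k * (p ^ 2 + q ^ 2) := by positivity
    rw [div_mul_eq_mul_div, le_div_iff₀ (by positivity)]
    have : f * (f * κ ^ 2) ≤ f * (8 * (k * (p ^ 2 + q ^ 2))) := by linarith
    have := le_of_mul_le_mul_left this h0
    linarith

/-- Convergence rate of the nuclear norm estimator on the event where the scores are dominated by
the penalties and restricted strong convexity holds. -/
theorem frobSq_estimator_le {X M0 Th0 E M Th : Matrix m n ℝ} {ν₁ ν₂ c ρ a κ : ℝ} {k : ℕ}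
    (hν₁ : 0 < ν₁) (hν₂ : 0 < ν₂) (hc : 0 < c) (hc1 : c < 1)
    (h12 : ν₁ ≤ ρ * ν₂) (h21 : ν₂ ≤ ρ * ν₁)
    (hXE : 2 * opNorm (X ⊙ E) ≤ (1 - c) * ν₁) (hE : 2 * opNorm E ≤ (1 - c) * ν₂)
    (ha : ρ * (2 - c) / c ≤ a) (hκ : 0 < κ)
    (hRSC : RestrictedStrongConvexity X M0 Th0 a κ) (hM0 : M0.rank ≤ k) (hTh0 : Th0.rank ≤ k)
    (hest : IsNuclearNormEstimator (M0 + X ⊙ Th0 + E) X ν₁ ν₂ M Th) :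
    frobSq (M - M0) + frobSq (Th - Th0) ≤ 16 * k / κ ^ 2 * (ν₂ ^ 2 + ν₁ ^ 2) := by
  set D1 := M - M0 with hD1
  set D2 := Th - Th0 with hD2
  have hopt := hest M0 Th0
  simp only [penalizedLoss] at hopt
  have e1 : M0 + X ⊙ Th0 + E - M0 - X ⊙ Th0 = E := by abel
  -- At the truth the residual is `E`; at the estimate it is `E` minus the fitted error, so `frobSq
  -- E` cancels from the comparison.
  have e2 : M0 + X ⊙ Th0 + E - M - X ⊙ Th = E + -(D1 + X ⊙ D2) := by
    ext i j
    simp [hD1, hD2, hadamard_apply]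
    ring
  have e3 : frobSq (-(D1 + X ⊙ D2)) = frobSq (D1 + D2 ⊙ X) := by
    rw [hadamard_comm X D2]
    simp only [frobSq, Matrix.neg_apply, neg_sq]
  rw [e1, e2, frobSq_add, e3, frobInner_neg_right, frobInner_add_right,
    frobInner_hadamard] at hopt
  have hM : M0 + D1 = M := by simp [hD1]
  have hTh : Th0 + D2 = Th := by simp [hD2]
  have s1 := nuclearNorm_sub_le M0 D1
  have s2 := nuclearNorm_sub_le Th0 D2
  rw [hM] at s1
  rw [hTh] at s2
  have i1 := frobInner_le E D1
  have i2 := frobInner_le (X ⊙ E) D2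
  have t1 := nuclearNorm_le_low_add_off M0 D1
  have t2 := nuclearNorm_le_low_add_off Th0 D2
  set L1 := nuclearNorm (lowProj M0 D1)
  set L2 := nuclearNorm (lowProj Th0 D2)
  set O1 := nuclearNorm (offProj M0 D1) with hO1
  set O2 := nuclearNorm (offProj Th0 D2) with hO2
  have hL1 : 0 ≤ L1 := nuclearNorm_nonneg _
  have hL2 : 0 ≤ L2 := nuclearNorm_nonneg _
  have hO1 : 0 ≤ O1 := nuclearNorm_nonneg _
  have hO2 : 0 ≤ O2 := nuclearNorm_nonneg _
  have j1 : 2 * frobInner E D1 ≤ (1 - c) * ν₂ * (L1 + O1) := by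
    have := mul_le_mul hE t1 (nuclearNorm_nonneg _) (by nlinarith)
    linarith
  have j2 : 2 * frobInner (X ⊙ E) D2 ≤ (1 - c) * ν₁ * (L2 + O2) := by
    have := mul_le_mul hXE t2 (nuclearNorm_nonneg _) (by nlinarith)
    linarith
  have k1 := mul_le_mul_of_nonneg_left s1 hν₂.le
  have k2 := mul_le_mul_of_nonneg_left s2 hν₁.le
  -- The scores contribute `1 - c` to both parts; the penalties contribute `+1` to the low part and
  -- `-1` to the off part.
  have main : frobSq (D1 + D2 ⊙ X) ≤
      (2 - c) * (ν₂ * L1 + ν₁ * L2) - c * (ν₂ * O1 + ν₁ * O2) := by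
    linarith
  have hpos := frobSq_nonneg (D1 + D2 ⊙ X)
  have hρ : 0 < ρ := by
    by_contra h
    have := mul_nonneg (sub_nonneg.2 (not_lt.1 h)) hν₂.le
    linarith
  have hcone : InLowRankCone M0 Th0 a D1 D2 := by
    -- To be used with `ν' = min ν₁ ν₂`: the off parts carry at least `ν'`, the low parts at most `ρ
    -- ν'`, so the penalties cancel.
    have hmul : ∀ ν', 0 < ν' → ν' ≤ ν₁ → ν' ≤ ν₂ → ν₁ ≤ ρ * ν' → ν₂ ≤ ρ * ν' →
        c * (O1 + O2) ≤ ρ * (2 - c) * (L1 + L2) := by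
      intro ν' h0 h1 h2 h3 h4
      refine le_of_mul_le_mul_left ?_ h0
      have a1 : ν' * (c * (O1 + O2)) ≤ c * (ν₂ * O1 + ν₁ * O2) := by
        have := mul_le_mul_of_nonneg_right h2 (mul_nonneg hc.le hO1)
        have := mul_le_mul_of_nonneg_right h1 (mul_nonneg hc.le hO2)
        linarith
      have a2 : (2 - c) * (ν₂ * L1 + ν₁ * L2) ≤ ν' * (ρ * (2 - c) * (L1 + L2)) := by
        have := mul_le_mul_of_nonneg_right h4 (mul_nonneg (by linarith : 0 ≤ 2 - c) hL1)
        have := mul_le_mul_of_nonneg_right h3 (mul_nonneg (by linarith : 0 ≤ 2 - c) hL2)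
        linarith
      linarith
    have h5 : c * (O1 + O2) ≤ ρ * (2 - c) * (L1 + L2) := by
      rcases le_total ν₁ ν₂ with h | h
      · exact hmul ν₁ hν₁ le_rfl h (by linarith) h21
      · exact hmul ν₂ hν₂ h le_rfl h12 (by linarith)
    have h6 : O1 + O2 ≤ ρ * (2 - c) / c * (L1 + L2) := by
      rw [div_mul_eq_mul_div, le_div_iff₀ hc]
      linarith
    have h7 := mul_le_mul_of_nonneg_right ha (add_nonneg hL1 hL2)
    change O1 + O2 ≤ a * L1 + a * L2
    linarith
  have hrsc := hRSC D1 D2 hcone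
  have n1 := nuclearNorm_sq_le _ (rank_lowProj_le hM0 D1)
  have n2 := nuclearNorm_sq_le _ (rank_lowProj_le hTh0 D2)
  have f1 := frobSq_lowProj_le M0 D1
  have f2 := frobSq_lowProj_le Th0 D2
  have g1 : L1 ^ 2 ≤ 2 * k * frobSq D1 := by
    refine n1.trans ?_
    push_cast
    gcongr
  have g2 : L2 ^ 2 ≤ 2 * k * frobSq D2 := by
    refine n2.trans ?_
    push_cast
    gcongr
  set f := frobSq D1 + frobSq D2 with hf
  have hf0 : 0 ≤ f := add_nonneg (frobSq_nonneg _) (frobSq_nonneg _)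
  -- Drops the off parts and uses `2 - c ≤ 2`.
  have u1 : κ * f ≤ 2 * (ν₂ * L1 + ν₁ * L2) := by
    have h1 := mul_nonneg hc.le (add_nonneg (mul_nonneg hν₂.le hO1) (mul_nonneg hν₁.le hO2))
    have h2 := mul_nonneg hc.le (add_nonneg (mul_nonneg hν₂.le hL1) (mul_nonneg hν₁.le hL2))
    rw [hf, mul_add]
    linear_combination hrsc + main + h1 + h2
  exact le_of_mul_le_cauchySchwarz hκ (Nat.cast_nonneg k) hf0 u1 (by rw [hf, mul_add]; exact add_le_add g1 g2)

end Projections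

/-! ### Quadratic forms and factor strength -/

section Strength

theorem Matrix.IsHermitian.mul_norm_sq_le_inner {n : Type*} [Fintype n] [DecidableEq n]
    {A : Matrix n n ℝ} (hA : A.IsHermitian) {l : ℝ} (h : ∀ i, l ≤ hA.eigenvalues i)
    (z : EuclideanSpace ℝ n) : l * ‖z‖ ^ 2 ≤ inner ℝ z (toEuclideanLin A z) := by
  set v := hA.eigenvectorBasis
  have hv : ∀ i, toEuclideanLin A (v i) = hA.eigenvalues i • v i := fun i => by
    rw [toLpLin_apply, hA.mulVec_eigenvectorBasis]
    rfl
  have h1 : inner ℝ z (toEuclideanLin A z) = ∑ i, hA.eigenvalues i * inner ℝ (v i) z ^ 2 := by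
    conv_lhs => arg 3; rw [← v.sum_repr' z]
    rw [map_sum, inner_sum]
    refine Finset.sum_congr rfl fun i _ => ?_
    rw [map_smul, hv, inner_smul_right, inner_smul_right, real_inner_comm]
    ring
  rw [h1, ← v.sum_sq_norm_inner_right z, Finset.mul_sum]
  refine Finset.sum_le_sum fun i _ => ?_
  rw [Real.norm_eq_abs, sq_abs]
  exact mul_le_mul_of_nonneg_right (h i) (sq_nonneg _)

theorem toEuclideanLin_mul_apply {m n p : Type*} [Fintype m] [Fintype n] [Fintype p]
    [DecidableEq n] [DecidableEq p] (A : Matrix m n ℝ) (B : Matrix n p ℝ)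
    (x : EuclideanSpace ℝ p) :
    toEuclideanLin (A * B) x = toEuclideanLin A (toEuclideanLin B x) := by
  rw [toLpLin_mul 2 2 2, LinearMap.comp_apply]

theorem norm_sq_toEuclideanLin {m n : Type*} [Fintype m] [Fintype n] [DecidableEq m]
    [DecidableEq n] (A : Matrix m n ℝ) (x : EuclideanSpace ℝ n) :
    ‖toEuclideanLin A x‖ ^ 2 = inner ℝ x (toEuclideanLin (Aᵀ * A) x) := by
  rw [toEuclideanLin_mul_apply, real_inner_comm, inner_toEuclideanLin_transpose,
    real_inner_self_eq_norm_sq]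

theorem card_smul_secondMoment {T K : ℕ} (F : Matrix (Fin T) (Fin K) ℝ) (S : Finset (Fin T)) :
    (S.card : ℝ) • secondMoment F S =
      (F.submatrix (Subtype.val : S → Fin T) id)ᵀ * F.submatrix (Subtype.val : S → Fin T) id := by
  have h : ∑ t ∈ S, vecMulVec (F t) (F t) =
      (F.submatrix (Subtype.val : S → Fin T) id)ᵀ *
        F.submatrix (Subtype.val : S → Fin T) id := by
    ext i j
    rw [Matrix.sum_apply, Matrix.mul_apply, ← Finset.sum_coe_sort S]
    rfl
  rw [← h, secondMoment, smul_smul]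
  rcases S.eq_empty_or_nonempty with rfl | hS
  · simp
  · rw [mul_inv_cancel₀, one_smul]
    exact_mod_cast hS.card_pos.ne'

theorem card_smul_secondMoment_univ {T K : ℕ} (F : Matrix (Fin T) (Fin K) ℝ) :
    (T : ℝ) • secondMoment F Finset.univ = Fᵀ * F := by
  have h := card_smul_secondMoment F Finset.univ
  rw [Finset.card_univ, Fintype.card_fin] at h
  rw [h]
  ext i j
  simp only [Matrix.mul_apply, transpose_apply, submatrix_apply, id_eq]
  exact Finset.sum_coe_sort Finset.univ fun t => F t i * F t j

theorem onSample_mul_transpose {N T K : ℕ} (L : Matrix (Fin N) (Fin K) ℝ)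
    (F : Matrix (Fin T) (Fin K) ℝ) (S : Finset (Fin T)) :
    onSample (L * Fᵀ) S = L * (F.submatrix (Subtype.val : S → Fin T) id)ᵀ := rfl

theorem secondMoment_posSemidef {T K : ℕ} (F : Matrix (Fin T) (Fin K) ℝ) :
    (secondMoment F Finset.univ).PosSemidef := by
  refine Matrix.PosSemidef.smul (Matrix.posSemidef_sum _ fun t _ => ?_) (by positivity)
  simpa using Matrix.posSemidef_vecMulVec_self_star (F t)

open scoped MatrixOrder in
theorem exists_sqrt_strengthMatrix {N T K : ℕ} (L : Matrix (Fin N) (Fin K) ℝ)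
    (F : Matrix (Fin T) (Fin K) ℝ) :
    ∃ R : Matrix (Fin K) (Fin K) ℝ, Rᵀ = R ∧ R * R = secondMoment F Finset.univ ∧
      strengthMatrix L F = R * secondMoment L Finset.univ * R :=
  ⟨CFC.sqrt (secondMoment F Finset.univ),
    (CFC.sqrt_nonneg (secondMoment F Finset.univ)).posSemidef.1,
    CFC.sqrt_mul_sqrt_self _ (secondMoment_posSemidef F).nonneg, rfl⟩

theorem sum_strengthEigenvalue {N T K : ℕ} (L : Matrix (Fin N) (Fin K) ℝ)
    (F : Matrix (Fin T) (Fin K) ℝ) :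
    ∑ j, strengthEigenvalue L F j = (strengthMatrix L F).trace := by
  rw [(strengthMatrix_isHermitian L F).trace_eq_sum_eigenvalues]
  simp only [strengthEigenvalue, IsHermitian.eigenvalues, RCLike.ofReal_real_eq_id, id_eq]
  rw [Equiv.sum_comp ((Fintype.equivOfCardEq (Fintype.card_fin _)).symm)
    (fun i => (strengthMatrix_isHermitian L F).eigenvalues₀ i)]
  exact Equiv.sum_comp (finCongr (Fintype.card_fin K).symm)
    (fun i => (strengthMatrix_isHermitian L F).eigenvalues₀ i)

/-- Cyclicity of the trace. It bounds the common component from above, as the rank threshold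
requires. -/
theorem frobSq_factor_eq {N T K : ℕ} (L : Matrix (Fin N) (Fin K) ℝ)
    (F : Matrix (Fin T) (Fin K) ℝ) :
    frobSq (L * Fᵀ) = N * T * ∑ j, strengthEigenvalue L F j := by
  obtain ⟨R, -, h2, h3⟩ := exists_sqrt_strengthMatrix L F
  rw [sum_strengthEigenvalue, h3, Matrix.trace_mul_comm, ← Matrix.mul_assoc, h2,
    ← frobInner_self, frobInner, transpose_mul, transpose_transpose]
  have : F * Lᵀ * (L * Fᵀ) = F * ((Lᵀ * L) * Fᵀ) := by simp only [Matrix.mul_assoc]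
  rw [this, Matrix.trace_mul_comm, Matrix.mul_assoc, ← card_smul_secondMoment_univ,
    ← card_smul_secondMoment_univ, Matrix.smul_mul, Matrix.mul_smul, Matrix.trace_smul,
    Matrix.trace_smul, Matrix.trace_mul_comm, smul_eq_mul, smul_eq_mul, mul_assoc]

/-- On the image of `L Σ_F^{1/2}`, the matrix `(L F')'` is bounded below in terms of the smallest
strength. -/
theorem strength_lower_bound {N T k : ℕ} (hN : 0 < N) (L : Matrix (Fin N) (Fin (k + 1)) ℝ)
    (F : Matrix (Fin T) (Fin (k + 1)) ℝ) {l : ℝ} (hl : 0 < l)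
    (h : l ≤ strengthEigenvalue L F (Fin.last k)) :
    ∃ P : EuclideanSpace ℝ (Fin (k + 1)) →ₗ[ℝ] EuclideanSpace ℝ (Fin N),
      Function.Injective P ∧
      ∀ z, l * (N * T) * ‖P z‖ ^ 2 ≤ ‖toEuclideanLin (F * Lᵀ) (P z)‖ ^ 2 := by
  obtain ⟨R, hRt, hRR, hSdef⟩ := exists_sqrt_strengthMatrix L F
  have hS := strengthMatrix_isHermitian L F
  set S := strengthMatrix L F with hSS
  have hSt : Sᵀ = S := hS
  have heig : ∀ i, l ≤ hS.eigenvalues i := fun i => by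
    refine h.trans (hS.eigenvalues₀_antitone ?_)
    rw [Fin.le_def]
    have := ((Fintype.equivOfCardEq (Fintype.card_fin (Fintype.card (Fin (k+1))))).symm i).2
    simp only [Fintype.card_fin] at this
    simp only [Fin.val_cast, Fin.val_last]
    omega
  have hquad := hS.mul_norm_sq_le_inner heig
  -- This is `S² ≥ l S`. With `P = L R` one has `P'P = N S` and `(F L' P)'(F L' P) = N² T S²`, so
  -- the required bound is exactly this one, rescaled.
  have hSz : ∀ z, l * inner ℝ z (toEuclideanLin S z) ≤ ‖toEuclideanLin S z‖ ^ 2 := fun z => by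
    have h1 := hquad z
    have h2 := real_inner_le_norm z (toEuclideanLin S z)
    have h3 : l * ‖z‖ ≤ ‖toEuclideanLin S z‖ := by
      by_cases hz : ‖z‖ = 0
      · rw [hz, mul_zero]; exact norm_nonneg _
      · have : 0 < ‖z‖ := lt_of_le_of_ne (norm_nonneg _) (Ne.symm hz)
        refine le_of_mul_le_mul_left ?_ this
        linarith
    have := mul_le_mul_of_nonneg_right h3 (norm_nonneg (toEuclideanLin S z))
    have := mul_le_mul_of_nonneg_left h2 hl.le
    linarith
  have hLR : (L * R)ᵀ * (L * R) = (N : ℝ) • S := by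
    rw [hSdef, transpose_mul, hRt]
    have : R * Lᵀ * (L * R) = R * (Lᵀ * L) * R := by simp only [Matrix.mul_assoc]
    rw [this, ← card_smul_secondMoment_univ, Matrix.mul_smul, Matrix.smul_mul]
  have hP : ∀ z, ‖toEuclideanLin (L * R) z‖ ^ 2 = N * inner ℝ z (toEuclideanLin S z) := by
    intro z
    rw [norm_sq_toEuclideanLin, hLR, map_smul, LinearMap.smul_apply, inner_smul_right]
  have hFL : (F * Lᵀ * (L * R))ᵀ * (F * Lᵀ * (L * R)) = ((N : ℝ) ^ 2 * T) • (Sᵀ * S) := by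
    have e1 : F * Lᵀ * (L * R) = F * ((Lᵀ * L) * R) := by simp only [Matrix.mul_assoc]
    rw [e1, transpose_mul, transpose_mul, hRt, transpose_mul Lᵀ L, transpose_transpose]
    have e2 : R * (Lᵀ * L) * Fᵀ * (F * (Lᵀ * L * R)) =
        R * (Lᵀ * L) * (Fᵀ * F) * ((Lᵀ * L) * R) := by simp only [Matrix.mul_assoc]
    rw [e2, ← card_smul_secondMoment_univ, ← card_smul_secondMoment_univ, ← hRR, hSt, hSdef]
    simp only [Matrix.mul_smul, Matrix.smul_mul, smul_smul, Matrix.mul_assoc]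
    congr 1
    ring
  refine ⟨toEuclideanLin (L * R), (injective_iff_map_eq_zero _).2 fun z hz => ?_, fun z => ?_⟩
  · have h1 := hP z
    rw [hz, norm_zero] at h1
    have h2 := hquad z
    have hN' : (0 : ℝ) < N := by exact_mod_cast hN
    have h3 : inner ℝ z (toEuclideanLin S z) = 0 := by
      have : (N : ℝ) * inner ℝ z (toEuclideanLin S z) = 0 := by rw [← h1]; ring
      exact (mul_eq_zero.1 this).resolve_left hN'.ne'
    rw [h3] at h2
    have h4 : ‖z‖ ^ 2 ≤ 0 := le_of_mul_le_mul_left (by simpa using h2) hl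
    have h5 : ‖z‖ = 0 := by nlinarith [norm_nonneg z]
    exact norm_eq_zero.1 h5
  · rw [hP, ← toEuclideanLin_mul_apply, norm_sq_toEuclideanLin, hFL, map_smul,
      LinearMap.smul_apply, inner_smul_right, ← norm_sq_toEuclideanLin]
    have := mul_le_mul_of_nonneg_left (hSz z) (by positivity : (0 : ℝ) ≤ (N : ℝ) ^ 2 * T)
    linarith

/-- A perturbation of size `δ / 2` costs at most half of a form bounded below by `δ`, and `S` has at
least a quarter of the periods: together a factor `8`. -/
theorem subsample_lower_bound {T K : ℕ} (F : Matrix (Fin T) (Fin K) ℝ)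
    (S : Finset (Fin T)) {δ : ℝ} (hδ : 0 < δ)
    (hspec : ∀ x ∈ spectrum ℝ (secondMoment F Finset.univ), δ ≤ x)
    (hdiff : frobSq (secondMoment F S - secondMoment F Finset.univ) ≤ (δ / 2) ^ 2)
    (hcard : (T : ℝ) ≤ 4 * S.card) (y : EuclideanSpace ℝ (Fin K)) :
    ‖toEuclideanLin F y‖ ^ 2 ≤
      8 * ‖toEuclideanLin (F.submatrix (Subtype.val : S → Fin T) id) y‖ ^ 2 := by
  have hq := (secondMoment_isHermitian F Finset.univ).mul_norm_sq_le_inner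
    (fun i => hspec _ ((secondMoment_isHermitian F Finset.univ).eigenvalues_mem_spectrum_real i)) y
  rw [norm_sq_toEuclideanLin, norm_sq_toEuclideanLin, ← card_smul_secondMoment,
    ← card_smul_secondMoment_univ, map_smul, map_smul, LinearMap.smul_apply,
    LinearMap.smul_apply, inner_smul_right, inner_smul_right]
  have h1 : inner ℝ y (toEuclideanLin (secondMoment F S) y) =
      inner ℝ y (toEuclideanLin (secondMoment F Finset.univ) y) +
        inner ℝ y (toEuclideanLin (secondMoment F S - secondMoment F Finset.univ) y) := by
    rw [map_sub, LinearMap.sub_apply, inner_sub_right]; ring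
  set E := secondMoment F S - secondMoment F Finset.univ
  have h2 : opNorm E ≤ δ / 2 :=
    le_of_sq_le_sq ((opNorm_sq_le_frobSq E).trans hdiff) (by positivity)
  have h3 : |inner ℝ y (toEuclideanLin E y)| ≤ δ / 2 * ‖y‖ ^ 2 := by
    refine (abs_real_inner_le_norm _ _).trans ?_
    have := (norm_toEuclideanLin_le E y).trans (mul_le_mul_of_nonneg_right h2 (norm_nonneg y))
    nlinarith [norm_nonneg y]
  have h4 := neg_le_of_abs_le h3
  set q := inner ℝ y (toEuclideanLin (secondMoment F Finset.univ) y)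
  set p := inner ℝ y (toEuclideanLin (secondMoment F S) y)
  have h5 : q / 2 ≤ p := by linarith
  have h6 : 0 ≤ q := le_trans (by positivity) hq
  have h7 : (T : ℝ) * q ≤ 4 * S.card * q := mul_le_mul_of_nonneg_right hcard h6
  have h8 : (S.card : ℝ) * (q / 2) ≤ S.card * p := mul_le_mul_of_nonneg_left h5 (by positivity)
  linarith

theorem frobSq_transpose {m n : Type*} [Fintype m] [Fintype n] (A : Matrix m n ℝ) :
    frobSq Aᵀ = frobSq A := by
  rw [frobSq, Finset.sum_comm]; rfl

/-- The singular values of an estimate of the common component are of the order `√(NT)`. -/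
theorem sval_estimate_lower_bound {N T k : ℕ} (hN : 0 < N) (hT : 0 < T)
    (L : Matrix (Fin N) (Fin (k + 1)) ℝ)
    (F : Matrix (Fin T) (Fin (k + 1)) ℝ) (S : Finset (Fin T)) {l δ : ℝ} (hl : 0 < l)
    (hstr : l ≤ strengthEigenvalue L F (Fin.last k)) (hδ : 0 < δ)
    (hspec : ∀ x ∈ spectrum ℝ (secondMoment F Finset.univ), δ ≤ x)
    (hdiff : frobSq (secondMoment F S - secondMoment F Finset.univ) ≤ (δ / 2) ^ 2)
    (hcard : (T : ℝ) ≤ 4 * S.card) (B : Matrix (Fin N) S ℝ)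
    (hB : frobSq (B - onSample (L * Fᵀ) S) ≤ l * (N * T) / 32) :
    l * (N * T) / 32 ≤ sval B k ^ 2 := by
  obtain ⟨P, hP, hPz⟩ := strength_lower_bound hN L F hl hstr
  -- The subsample leaves `l N T / 8 = 4σ²`, so the signal is `2σ`; the error takes at most `σ`.
  set σ := √(l * (N * T) / 32) with hσ
  have hN' : (0 : ℝ) < N := by exact_mod_cast hN
  have hT' : (0 : ℝ) < T := by exact_mod_cast hT
  have hpos : 0 < l * (N * T) / 32 := by positivity
  have hσ0 : 0 < σ := Real.sqrt_pos.2 hpos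
  have hσ2 : σ ^ 2 = l * (N * T) / 32 := Real.sq_sqrt hpos.le
  have key : σ ≤ sval B k := by
    refine le_sval_of_forall_le P hP hσ0 fun z => ?_
    set E := B - onSample (L * Fᵀ) S
    have h1 := subsample_lower_bound F S hδ hspec hdiff hcard (toEuclideanLin Lᵀ (P z))
    rw [← toEuclideanLin_mul_apply, ← toEuclideanLin_mul_apply] at h1
    have h2 := hPz z
    set F' := F.submatrix (Subtype.val : S → Fin T) id
    have h3 : 2 * σ * ‖P z‖ ≤ ‖toEuclideanLin (F' * Lᵀ) (P z)‖ := by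
      refine le_of_sq_le_sq ?_ (norm_nonneg _)
      rw [mul_pow, mul_pow, hσ2]
      linarith
    have h4 : opNorm Eᵀ ≤ σ := by
      refine le_of_sq_le_sq ?_ hσ0.le
      rw [hσ2]
      refine (opNorm_sq_le_frobSq _).trans ?_
      rwa [frobSq_transpose]
    have h5 := (norm_toEuclideanLin_le Eᵀ (P z)).trans
      (mul_le_mul_of_nonneg_right h4 (norm_nonneg _))
    have h6 : Bᵀ = F' * Lᵀ + Eᵀ := by
      have : B = onSample (L * Fᵀ) S + E := by simp [E]
      rw [this, transpose_add, onSample_mul_transpose, transpose_mul, transpose_transpose]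
    rw [h6, map_add, LinearMap.add_apply]
    have h7 := norm_sub_le (toEuclideanLin (F' * Lᵀ) (P z) + toEuclideanLin Eᵀ (P z))
      (toEuclideanLin Eᵀ (P z))
    rw [add_sub_cancel_right] at h7
    linarith
  rw [← hσ2]
  exact pow_le_pow_left₀ hσ0.le key 2

end Strength

/-! ### Loadings and ranks -/

section Loadings

theorem frobSq_mul_le {m n p : Type*} [Fintype m] [Fintype n] [Fintype p] (A : Matrix m n ℝ)
    (B : Matrix n p ℝ) : frobSq (A * B) ≤ frobSq A * frobSq B := by
  rw [← frobSq_transpose B]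
  simp only [frobSq]
  rw [Finset.sum_mul]
  refine Finset.sum_le_sum fun i _ => ?_
  rw [Finset.mul_sum]
  exact Finset.sum_le_sum fun j _ => Finset.sum_mul_sq_le_sq_mul_sq _ _ _

theorem frobSq_smul {m n : Type*} [Fintype m] [Fintype n] (a : ℝ) (A : Matrix m n ℝ) :
    frobSq (a • A) = a ^ 2 * frobSq A := by
  simp [frobSq, Finset.mul_sum, mul_pow]

/-- A matrix with orthonormal columns that is close to `L H` makes `H` invertible. -/
theorem isUnit_of_frobSq_lt {N K : ℕ} {V L : Matrix (Fin N) (Fin K) ℝ}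
    {H : Matrix (Fin K) (Fin K) ℝ} (hV : Vᵀ * V = 1) (h : frobSq (V - L * H) < 1) :
    IsUnit H := by
  rw [← Matrix.mulVec_injective_iff_isUnit]
  refine (injective_iff_map_eq_zero (Matrix.mulVecLin H)).2 fun y hy => ?_
  rw [Matrix.mulVecLin_apply] at hy
  -- On the kernel of `H`, `V - L H` acts as the isometry `V`, impossible for a matrix of norm below
  -- one.
  set Y : Matrix (Fin K) Unit ℝ := Matrix.replicateCol Unit y with hY
  have hHY : H * Y = 0 := by
    rw [hY, ← Matrix.replicateCol_mulVec, hy]; rfl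
  have h1 : (V - L * H) * Y = V * Y := by
    rw [Matrix.sub_mul, Matrix.mul_assoc, hHY, Matrix.mul_zero, sub_zero]
  have h2 : frobSq (V * Y) = frobSq Y := by
    rw [← frobInner_self, ← frobInner_self, frobInner, frobInner, transpose_mul, Matrix.mul_assoc,
      ← Matrix.mul_assoc Vᵀ, hV, Matrix.one_mul]
  have h3 := frobSq_mul_le (V - L * H) Y
  rw [h1, h2] at h3
  have h4 : frobSq Y = 0 := by
    by_contra h0
    have : 0 < frobSq Y := lt_of_le_of_ne (frobSq_nonneg Y) (Ne.symm h0)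
    nlinarith
  have h5 : ∑ i, y i ^ 2 = 0 := by simpa [frobSq, hY] using h4
  rw [Finset.sum_eq_zero_iff_of_nonneg fun _ _ => sq_nonneg _] at h5
  ext i
  simpa using h5 i (Finset.mem_univ i)

/-- The eigenvector equation gives `V = B Z` for `Z = B' V D`, where `Z'Z = D` is the inverse of the
squared singular values. Replacing `B` by `L F'` costs only `(B - L F') Z`, so the rotation is `√N
F' Z`. -/
theorem exists_rotation {N K : ℕ} {n : Type*} [Fintype n] [DecidableEq n] (hN : 0 < N)
    {B : Matrix (Fin N) n ℝ} {L : Matrix (Fin N) (Fin K) ℝ} {F : Matrix n (Fin K) ℝ}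
    {s e : ℝ} (hs : 0 < s) (hB : ∀ j : Fin K, s ≤ sval B j ^ 2)
    (he : frobSq (B - L * Fᵀ) ≤ e) (hes : K * e / s < 1)
    {Lt : Matrix (Fin N) (Fin K) ℝ} (hLt : IsLoadingEstimator B Lt) :
    ∃ H : Matrix (Fin K) (Fin K) ℝ, IsUnit H ∧ frobSq (Lt - L * H) / N ≤ K * e / s := by
  obtain ⟨V, hV, hVe, rfl⟩ := hLt
  set D : Matrix (Fin K) (Fin K) ℝ := diagonal fun j => (sval B j ^ 2)⁻¹ with hD
  set Λ : Matrix (Fin K) (Fin K) ℝ := diagonal fun j => sval B j ^ 2 with hΛ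
  have hpos : ∀ j : Fin K, 0 < sval B j ^ 2 := fun j => hs.trans_le (hB j)
  have hΛD : Λ * D = 1 := by
    rw [hΛ, hD, diagonal_mul_diagonal, ← diagonal_one]
    congr 1
    ext j
    exact mul_inv_cancel₀ (hpos j).ne'
  have hBV : B * Bᵀ * V = V * Λ := by
    ext i j
    have := congrFun (hVe j) i
    rw [hΛ, mul_diagonal, Matrix.mul_apply]
    simpa [mulVec, dotProduct, mul_comm] using this
  set Z := Bᵀ * V * D with hZ
  have hBZ : B * Z = V := by
    rw [hZ, ← Matrix.mul_assoc, ← Matrix.mul_assoc, hBV, Matrix.mul_assoc, hΛD, Matrix.mul_one]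
  have hZZ : Zᵀ * Z = D := by
    have : Dᵀ = D := diagonal_transpose _
    rw [hZ, transpose_mul, transpose_mul, transpose_transpose, this]
    have e1 : D * (Vᵀ * B) * (Bᵀ * V * D) = D * Vᵀ * ((B * Bᵀ * V) * D) := by
      simp only [Matrix.mul_assoc]
    rw [e1, hBV, Matrix.mul_assoc V, hΛD, Matrix.mul_one, Matrix.mul_assoc, hV, Matrix.mul_one]
  have hZf : frobSq Z ≤ K / s := by
    rw [← frobInner_self, frobInner, hZZ, hD, trace_diagonal]
    calc ∑ j : Fin K, (sval B j ^ 2)⁻¹ ≤ ∑ _j : Fin K, s⁻¹ :=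
          Finset.sum_le_sum fun j _ => inv_anti₀ hs (hB j)
      _ = K / s := by simp [div_eq_mul_inv]
  have hE : V - L * (Fᵀ * Z) = (B - L * Fᵀ) * Z := by
    rw [Matrix.sub_mul, hBZ, Matrix.mul_assoc]
  have hEf : frobSq (V - L * (Fᵀ * Z)) ≤ K * e / s := by
    rw [hE]
    refine (frobSq_mul_le _ _).trans ?_
    have := mul_le_mul he hZf (frobSq_nonneg _) ((frobSq_nonneg _).trans he)
    calc _ ≤ e * (K / s) := this
      _ = K * e / s := by ring
  have hN' : (0 : ℝ) < N := by exact_mod_cast hN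
  have hunit := isUnit_of_frobSq_lt hV (hEf.trans_lt hes)
  refine ⟨√N • (Fᵀ * Z), ?_, ?_⟩
  · exact hunit.smul (Units.mk0 (√(N : ℝ)) (Real.sqrt_pos.2 hN').ne')
  · rw [Matrix.mul_smul, ← smul_sub, frobSq_smul, Real.sq_sqrt hN'.le,
      mul_div_cancel_left₀ _ hN'.ne']
    exact hEf

theorem rankEstimate_eq {m n : Type*} [Fintype m] [Fintype n] [DecidableEq n]
    {B : Matrix m n ℝ} {ν : ℝ} {k : ℕ} (h1 : √(ν * opNorm B) ≤ sval B k)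
    (h2 : sval B (k + 1) < √(ν * opNorm B)) : rankEstimate ν B = k + 1 := by
  have hpos : 0 < sval B k := (sval_nonneg B (k + 1)).trans_lt (h2.trans_le h1)
  have hk : k < B.rank := by
    by_contra h
    exact hpos.ne' (sval_eq_zero_of_rank_le (not_lt.1 h))
  have hm := hk.trans_le (Matrix.rank_le_card_height B)
  have hn := hk.trans_le (Matrix.rank_le_card_width B)
  rw [rankEstimate]
  have : (Finset.range (min (Fintype.card m) (Fintype.card n))).filter
      (fun j => √(ν * opNorm B) ≤ sval B j) = Finset.range (k + 1) := by
    ext j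
    simp only [Finset.mem_filter, Finset.mem_range, lt_min_iff]
    constructor
    · rintro ⟨-, hj⟩
      by_contra hkj
      exact absurd (hj.trans (sval_antitone B (not_lt.1 hkj))) (not_le.2 h2)
    · intro hj
      exact ⟨⟨by omega, by omega⟩, h1.trans (sval_antitone B (by omega))⟩
  rw [this, Finset.card_range]

end Loadings

/-! ### Events with probability tending to one -/

section Stochastic

variable {Ω : Type*} [MeasurableSpace Ω]

/-- The filter of sequences of events whose probabilities tend to one. -/
def probFilter (μ : Measure Ω) : Filter (ℕ × Ω) where
  sets := {s | Tendsto (fun n => μ {ω | (n, ω) ∉ s}) atTop (𝓝 0)}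
  univ_sets := by simp
  sets_of_superset {s u} hs hsu := by
    refine tendsto_of_tendsto_of_tendsto_of_le_of_le tendsto_const_nhds hs
      (fun _ => zero_le) fun n => measure_mono fun ω h h' => h (hsu h')
  inter_sets {s u} hs hu := by
    have h := Tendsto.add (show Tendsto _ _ _ from hs) (show Tendsto _ _ _ from hu)
    rw [add_zero] at h
    refine tendsto_of_tendsto_of_tendsto_of_le_of_le tendsto_const_nhds h
      (fun _ => zero_le) fun n => (measure_mono ?_).trans (measure_union_le _ _)
    intro ω hω
    by_contra h'
    simp only [Set.mem_union, Set.mem_ofPred_eq, not_or, not_not] at h'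
    exact hω h'

theorem withProbTendingToOne_iff {μ : Measure Ω} {p : ℕ → Ω → Prop} :
    WithProbTendingToOne μ p ↔ ∀ᶠ x in probFilter μ, p x.1 x.2 := Iff.rfl

theorem eventually_probFilter_of_eventually {μ : Measure Ω} {p : ℕ → Prop}
    (h : ∀ᶠ n in atTop, p n) : ∀ᶠ x in probFilter μ, p x.1 := by
  change Tendsto (fun n => μ {ω : Ω | ¬ p n}) atTop (𝓝 0)
  refine Tendsto.congr' ?_ tendsto_const_nhds
  filter_upwards [h] with n hn
  simp [hn]

theorem IsLittleOPOne.eventually_abs_le {μ : Measure Ω} {Z : ℕ → Ω → ℝ}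
    (h : IsLittleOPOne μ Z) {ε : ℝ} (hε : 0 < ε) :
    ∀ᶠ x in probFilter μ, |Z x.1 x.2| ≤ ε := by
  have := h ε hε
  change Tendsto (fun n => μ {ω | ¬ |Z n ω| ≤ ε}) atTop (𝓝 0)
  simpa only [not_le] using this

theorem IsBigOP.of_eventually_le {μ : Measure Ω} {Z : ℕ → Ω → ℝ≥0∞} {r : ℕ → Ω → ℝ} {C : ℝ}
    (hC : 0 < C) (h : ∀ᶠ x in probFilter μ, Z x.1 x.2 ≤ ENNReal.ofReal (C * r x.1 x.2)) :
    IsBigOP μ Z r := by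
  intro ε hε
  refine ⟨C, hC, ?_⟩
  have h' : Tendsto (fun n => μ {ω | ¬ Z n ω ≤ ENNReal.ofReal (C * r n ω)}) atTop (𝓝 0) := h
  simpa only [not_le] using h'.eventually_le_const hε

end Stochastic

/-! ### Samples -/

section Samples

/-- Selecting columns is right multiplication by an isometry. It transfers the full-sample score
bounds to the subsamples. -/
theorem opNorm_onSample_le {N T : ℕ} (Z : Matrix (Fin N) (Fin T) ℝ) (S : Finset (Fin T)) :
    opNorm (onSample Z S) ≤ opNorm Z := by
  set J : Matrix (Fin T) S ℝ := (1 : Matrix (Fin T) (Fin T) ℝ).submatrix id Subtype.val with hJ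
  have h1 : onSample Z S = Z * J := by
    ext i j
    simp [onSample, hJ, Matrix.mul_apply, Matrix.one_apply]
  have h2 : Jᵀ * J = 1 := by
    rw [hJ, transpose_submatrix, transpose_one,
      ← Matrix.submatrix_mul _ _ _ _ _ Function.bijective_id, Matrix.one_mul,
      Matrix.submatrix_one _ Subtype.val_injective]
  refine opNorm_le_of_forall (opNorm_nonneg Z) fun x => ?_
  rw [h1, toEuclideanLin_mul_apply]
  refine (norm_toEuclideanLin_le Z _).trans (le_of_eq ?_)
  congr 1
  refine (sq_eq_sq₀ (norm_nonneg _) (norm_nonneg _)).1 ?_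
  rw [norm_sq_toEuclideanLin, h2, toLpLin_one, LinearMap.id_apply, real_inner_self_eq_norm_sq]

theorem frobSq_onSample_univ {N T : ℕ} (Z : Matrix (Fin N) (Fin T) ℝ) :
    frobSq (onSample Z Finset.univ) = frobSq Z :=
  Finset.sum_congr rfl fun i _ => Finset.sum_coe_sort Finset.univ fun t => Z i t ^ 2

theorem rank_onSample_mul_le {N T K : ℕ} (L : Matrix (Fin N) (Fin K) ℝ)
    (F : Matrix (Fin T) (Fin K) ℝ) (S : Finset (Fin T)) :
    (onSample (L * Fᵀ) S).rank ≤ K := by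
  rw [onSample_mul_transpose]
  exact (Matrix.rank_mul_le_left _ _).trans
    ((Matrix.rank_le_card_width L).trans_eq (Fintype.card_fin K))

theorem SampleKind.le_four_mul_card {T : ℕ} (hT : 4 ≤ T) {t : Fin T} {I : Finset (Fin T)}
    (ht : t ∉ I) (hI : I.card = (T - 1) / 2) (s : SampleKind) :
    (T : ℝ) ≤ 4 * (s.periods t I).card := by
  have : T ≤ 4 * (s.periods t I).card := by
    cases s with
    | first => simp only [SampleKind.periods]; omega
    | second =>
      simp only [SampleKind.periods, Finset.card_compl, Finset.card_insert_of_notMem ht,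
        Fintype.card_fin]
      omega
    | full => simp only [SampleKind.periods, Finset.card_univ, Fintype.card_fin]; omega
  exact_mod_cast this

theorem frobSq_le_two_mul {m n : Type*} [Fintype m] [Fintype n] (A B : Matrix m n ℝ) :
    frobSq A ≤ 2 * frobSq (A - B) + 2 * frobSq B := by
  simp only [frobSq, Finset.mul_sum, ← Finset.sum_add_distrib]
  refine Finset.sum_le_sum fun i _ => Finset.sum_le_sum fun j _ => ?_
  rw [Matrix.sub_apply]
  nlinarith [sq_nonneg (A i j - 2 * B i j)]

/-- The width `k` is the random estimated rank; substituting `k = K` lets the fixed-width bound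
apply. -/
theorem exists_loadingError_le {N k K : ℕ} {n : Type*} [Fintype n] [DecidableEq n]
    {B : Matrix (Fin N) n ℝ} {L : Matrix (Fin N) (Fin K) ℝ} {x : ℝ}
    (h : ∀ Lt : Matrix (Fin N) (Fin K) ℝ, IsLoadingEstimator B Lt →
      ∃ H : Matrix (Fin K) (Fin K) ℝ, IsUnit H ∧ frobSq (Lt - L * H) / N ≤ x)
    (hk : k = K) {Lt : Matrix (Fin N) (Fin k) ℝ} (hLt : IsLoadingEstimator B Lt) :
    ∃ H : Matrix (Fin K) (Fin K) ℝ, IsUnit H ∧ loadingError Lt L H ≤ ENNReal.ofReal x := by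
  subst hk
  obtain ⟨H, hH, hle⟩ := h Lt hLt
  refine ⟨H, hH, ?_⟩
  rw [loadingError, dif_pos rfl]
  exact ENNReal.ofReal_le_ofReal hle

end Samples

/-! ### Recovery of the factor structure -/

section Recovery

/-- The singular value threshold separates the first `k + 1` singular values from the others. -/
theorem rankEstimate_eq_of_bounds {m n : Type*} [Fintype m] [Fintype n] [DecidableEq n]
    {B M : Matrix m n ℝ} {k : ℕ} {ν V d C D l τ : ℝ} (hν : 0 < ν) (hd : 0 < d) (hC : 0 < C)
    (hl : 0 < l) (hM : M.rank ≤ k + 1)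
    (hMτ : frobSq M ≤ τ * d) (hBM : frobSq (B - M) ≤ C * V) (hsval : l * d ≤ sval B k ^ 2)
    (hνV : ν ^ 2 ≤ V) (hVν : V ≤ D * ν ^ 2) (hV1 : C * V ≤ d)
    (hV2 : 2 * (1 + τ) * V ≤ l ^ 2 * d) (hV3 : (C * D) ^ 2 * V < l * d) :
    rankEstimate ν B = k + 1 := by
  have hs0 := sval_nonneg B k
  have hop := opNorm_nonneg B
  -- The signal contributes `2τd` and the error `2CV ≤ 2d`.
  have hopB : opNorm B ^ 2 ≤ 2 * (1 + τ) * d := by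
    have h1 := opNorm_sq_le_frobSq B
    have h2 := frobSq_le_two_mul B M
    linarith
  have hsop := sval_le_opNorm B k
  refine rankEstimate_eq ?_ ?_
  · rw [Real.sqrt_le_left hs0]
    refine le_trans ?_ hsval
    refine le_of_sq_le_sq ?_ (by positivity)
    rw [mul_pow]
    calc ν ^ 2 * opNorm B ^ 2 ≤ V * (2 * (1 + τ) * d) :=
          mul_le_mul hνV hopB (sq_nonneg _) ((sq_nonneg ν).trans hνV)
      _ = 2 * (1 + τ) * V * d := by ring
      _ ≤ l ^ 2 * d * d := mul_le_mul_of_nonneg_right hV2 hd.le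
      _ = (l * d) ^ 2 := by ring
  · rw [Real.lt_sqrt (sval_nonneg B _)]
    have h1 : sval B (k + 1) ^ 2 ≤ C * V :=
      (pow_le_pow_left₀ (sval_nonneg B _) (sval_le_opNorm_sub hM) 2).trans
        ((opNorm_sq_le_frobSq _).trans hBM)
    -- The squared noise is at most `CDν²`, so it falls below the squared threshold `ν‖B‖` once
    -- `‖B‖` exceeds `CDν`.
    have h2 : C * D * ν < opNorm B := by
      refine lt_of_lt_of_le ?_ hsop
      refine lt_of_pow_lt_pow_left₀ 2 hs0 (lt_of_lt_of_le ?_ hsval)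
      rw [mul_pow]
      exact (mul_le_mul_of_nonneg_left hνV (sq_nonneg _)).trans_lt hV3
    calc sval B (k + 1) ^ 2 ≤ C * V := h1
      _ ≤ C * (D * ν ^ 2) := mul_le_mul_of_nonneg_left hVν hC.le
      _ = ν * (C * D * ν) := by ring
      _ < ν * opNorm B := mul_lt_mul_of_pos_left h2 hν

variable {Ω : Type*} [MeasurableSpace Ω]

/-- Serves both `(Λ, F)` and `(A, G)`. Here `ν` is the penalty in the rank threshold, that of the
other component, and `V` stands for `ν₁² + ν₂²`. -/
theorem factor_recovery {μ : Measure Ω} {N T : ℕ → ℕ} (hN : Tendsto N atTop atTop)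
    (hT : Tendsto T atTop atTop) {k : ℕ}
    (L : ∀ n, Matrix (Fin (N n)) (Fin (k + 1)) ℝ)
    (F : ∀ n, Ω → Matrix (Fin (T n)) (Fin (k + 1)) ℝ)
    (t : ∀ n, Fin (T n)) (I : ∀ n, Ω → Finset (Fin (T n)))
    (htI : ∀ n ω, t n ∉ I n ω) (hI : ∀ n ω, (I n ω).card = (T n - 1) / 2)
    {ν V : ℕ → Ω → ℝ} {C D : ℝ} (hν : ∀ n ω, 0 < ν n ω) (hC : 0 < C) (hD : 0 < D)
    (hνV : ∀ᶠ x in probFilter μ, ν x.1 x.2 ^ 2 ≤ V x.1 x.2)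
    (hVν : ∀ᶠ x in probFilter μ, V x.1 x.2 ≤ D * ν x.1 x.2 ^ 2)
    (Bt : ∀ n ω (s : SampleKind), Matrix (Fin (N n)) (s.periods (t n) (I n ω)) ℝ)
    (hBt : ∀ s : SampleKind, ∀ᶠ x in probFilter μ,
      frobSq (Bt x.1 x.2 s - onSample (L x.1 * (F x.1 x.2)ᵀ) (s.periods (t x.1) (I x.1 x.2))) ≤
        C * V x.1 x.2)
    (hstr : StrongDistinctFactors μ L F) (hbal : BalancedFactors μ F t I)
    (hV : IsLittleOPOne μ fun n ω => V n ω / (N n * T n)) :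
    (∃ C', 0 < C' ∧ ∀ s : SampleKind, ∀ᶠ x in probFilter μ,
      ∀ Lt : Matrix (Fin (N x.1)) (Fin (k + 1)) ℝ, IsLoadingEstimator (Bt x.1 x.2 s) Lt →
        ∃ H : Matrix (Fin (k + 1)) (Fin (k + 1)) ℝ, IsUnit H ∧
          frobSq (Lt - L x.1 * H) / N x.1 ≤ C' * (V x.1 x.2 / (N x.1 * T x.1))) ∧
    ∀ᶠ x in probFilter μ, rankEstimate (ν x.1 x.2) (Bt x.1 x.2 .full) = k + 1 := by
  obtain ⟨c, -, hcpos, hc⟩ := hstr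
  obtain ⟨hdiff, δ, hδ, hspec⟩ := hbal
  -- Half the limit of the weakest strength bounds the random strength from below with probability
  -- tending to one.
  set l := c (Fin.last k) / 2 with hl
  have hl0 : 0 < l := half_pos (hcpos _)
  have hNpos : ∀ᶠ x in probFilter μ, 0 < N x.1 :=
    eventually_probFilter_of_eventually (hN.eventually_gt_atTop 0)
  have hTbig : ∀ᶠ x in probFilter μ, 4 ≤ T x.1 :=
    eventually_probFilter_of_eventually (hT.eventually_ge_atTop 4)
  have hdpos : ∀ᶠ x in probFilter μ, (0 : ℝ) < N x.1 * T x.1 := by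
    filter_upwards [hNpos, hTbig] with x h1 h2
    have : 0 < T x.1 := by omega
    positivity
  have hVsmall : ∀ η : ℝ, 0 < η →
      ∀ᶠ x in probFilter μ, V x.1 x.2 ≤ η * (N x.1 * T x.1) := by
    intro η hη
    filter_upwards [hV.eventually_abs_le hη, hdpos] with x h1 h2
    rw [← div_le_iff₀ h2]
    exact (le_abs_self _).trans h1
  have hstr_low : ∀ᶠ x in probFilter μ,
      l ≤ strengthEigenvalue (L x.1) (F x.1 x.2) (Fin.last k) := by
    filter_upwards [(hc (Fin.last k)).eventually_abs_le hl0] with x hx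
    have := (abs_le.1 hx).1
    linarith
  have hstr_up : ∀ᶠ x in probFilter μ,
      ∑ j, strengthEigenvalue (L x.1) (F x.1 x.2) j ≤ ∑ j, (c j + 1) := by
    have : ∀ᶠ x in probFilter μ, ∀ j,
        |strengthEigenvalue (L x.1) (F x.1 x.2) j - c j| ≤ 1 :=
      eventually_all.2 fun j => (hc j).eventually_abs_le one_pos
    filter_upwards [this] with x hx
    refine Finset.sum_le_sum fun j _ => ?_
    have := (abs_le.1 (hx j)).2
    linarith
  have hsval : ∀ s : SampleKind, ∀ᶠ x in probFilter μ,
      l * (N x.1 * T x.1) / 32 ≤ sval (Bt x.1 x.2 s) k ^ 2 := by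
    intro s
    filter_upwards [hNpos, hTbig, hstr_low, withProbTendingToOne_iff.1 hspec, hBt s,
      (hdiff s).eventually_abs_le (ε := (δ / 2) ^ 2) (by positivity),
      hVsmall (l / (32 * C)) (by positivity)] with x h1 h2 h3 h4 h5 h6 h7
    refine sval_estimate_lower_bound h1 (by omega) (L x.1) (F x.1 x.2) _ hl0 h3 hδ h4
      ((le_abs_self _).trans h6) (s.le_four_mul_card h2 (htI _ _) (hI _ _)) _ (h5.trans ?_)
    calc C * V x.1 x.2 ≤ C * (l / (32 * C) * (N x.1 * T x.1)) :=
          mul_le_mul_of_nonneg_left h7 hC.le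
      _ = l * (N x.1 * T x.1) / 32 := by field_simp
  set C' : ℝ := ((k + 1 : ℕ) : ℝ) * C * 32 / l with hC'
  have hC'pos : 0 < C' := by positivity
  refine ⟨⟨C', hC'pos, fun s => ?_⟩, ?_⟩
  -- Smallness `1 / (2C')` keeps the error at most `1/2`, below the bound `1` that makes the
  -- rotation invertible.
  · filter_upwards [hNpos, hdpos, hsval s, hBt s, hVsmall (1 / (2 * C')) (by positivity)] with
      x h1 h2 h3 h4 h5 Lt hLt
    have heq : ((k + 1 : ℕ) : ℝ) * (C * V x.1 x.2) / (l * (N x.1 * T x.1) / 32) =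
        C' * (V x.1 x.2 / (N x.1 * T x.1)) := by
      rw [hC']
      field_simp
    rw [onSample_mul_transpose] at h4
    rw [← heq]
    refine exists_rotation h1 (by positivity) (fun j => ?_) h4 ?_ hLt
    · exact h3.trans (pow_le_pow_left₀ (sval_nonneg _ _)
        (sval_antitone _ (Nat.le_of_lt_succ j.2)) 2)
    · rw [heq]
      have : V x.1 x.2 / (N x.1 * T x.1) ≤ 1 / (2 * C') := (div_le_iff₀ h2).2 h5
      calc _ ≤ C' * (1 / (2 * C')) := mul_le_mul_of_nonneg_left this hC'pos.le
        _ = 1 / 2 := by field_simp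
        _ < 1 := by norm_num
  · set τ := ∑ j, (c j + 1) with hτ
    have hτ0 : 0 ≤ τ := Finset.sum_nonneg fun j _ => by linarith [hcpos j]
    filter_upwards [hdpos, hsval .full, hBt .full, hνV, hVν, hstr_up,
      hVsmall (1 / C) (by positivity),
      hVsmall ((l / 32) ^ 2 / (2 * (1 + τ))) (by positivity),
      -- `l / 64` instead of `l / 32` makes the last inequality strict.
      hVsmall (l / 64 / (C * D) ^ 2) (by positivity)] with x h1 h2 h3 h4 h5 h6 h7 h8 h9
    refine rankEstimate_eq_of_bounds (l := l / 32) (τ := τ) (hν x.1 x.2) h1 hC (by positivity)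
      (rank_onSample_mul_le (L x.1) (F x.1 x.2) _) ?_ h3 (by linarith) h4 h5 ?_ ?_ ?_
    · refine (frobSq_onSample_univ (L x.1 * (F x.1 x.2)ᵀ)).trans_le ?_
      rw [frobSq_factor_eq, mul_comm τ]
      exact mul_le_mul_of_nonneg_left h6 h1.le
    · calc C * V x.1 x.2 ≤ C * (1 / C * (N x.1 * T x.1)) := mul_le_mul_of_nonneg_left h7 hC.le
        _ = N x.1 * T x.1 := by field_simp
    · calc 2 * (1 + τ) * V x.1 x.2
          ≤ 2 * (1 + τ) * ((l / 32) ^ 2 / (2 * (1 + τ)) * (N x.1 * T x.1)) :=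
            mul_le_mul_of_nonneg_left h8 (by positivity)
        _ = (l / 32) ^ 2 * (N x.1 * T x.1) := by field_simp
    · calc (C * D) ^ 2 * V x.1 x.2
          ≤ (C * D) ^ 2 * (l / 64 / (C * D) ^ 2 * (N x.1 * T x.1)) :=
            mul_le_mul_of_nonneg_left h9 (by positivity)
        _ = l / 64 * (N x.1 * T x.1) := by field_simp
        _ < l / 32 * (N x.1 * T x.1) := mul_lt_mul_of_pos_right (by linarith) h1

/-- A measurable choice is not needed: on the good event a rotation is chosen pointwise. -/
theorem exists_rotation_sequence {μ : Measure Ω} {N : ℕ → ℕ} {K : ℕ}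
    {L : ∀ n, Matrix (Fin (N n)) (Fin K) ℝ} {Kh : ℕ → Ω → ℕ}
    {Lt : ∀ n ω, Matrix (Fin (N n)) (Fin (Kh n ω)) ℝ} {r : ℕ → Ω → ℝ} {C : ℝ} (hC : 0 < C)
    (h : ∀ᶠ x in probFilter μ, ∃ H : Matrix (Fin K) (Fin K) ℝ, IsUnit H ∧
      loadingError (Lt x.1 x.2) (L x.1) H ≤ ENNReal.ofReal (C * r x.1 x.2)) :
    ∃ H : ℕ → Ω → Matrix (Fin K) (Fin K) ℝ,
      IsBigOP μ (fun n ω => loadingError (Lt n ω) (L n) (H n ω)) r ∧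
      ∀ᶠ x in probFilter μ, IsUnit (H x.1 x.2) := by
  classical
  have hch : ∀ n ω, ∃ H : Matrix (Fin K) (Fin K) ℝ,
      (∃ H : Matrix (Fin K) (Fin K) ℝ, IsUnit H ∧
        loadingError (Lt n ω) (L n) H ≤ ENNReal.ofReal (C * r n ω)) →
      IsUnit H ∧ loadingError (Lt n ω) (L n) H ≤ ENNReal.ofReal (C * r n ω) := fun n ω => by
    by_cases hex : ∃ H : Matrix (Fin K) (Fin K) ℝ, IsUnit H ∧
        loadingError (Lt n ω) (L n) H ≤ ENNReal.ofReal (C * r n ω)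
    · exact ⟨hex.choose, fun _ => hex.choose_spec⟩
    · exact ⟨1, fun h => absurd h hex⟩
  choose H hH using hch
  exact ⟨H, IsBigOP.of_eventually_le hC (h.mono fun x hx => (hH x.1 x.2 hx).2),
    h.mono fun x hx => (hH x.1 x.2 hx).1⟩

end Recovery

end

/-! ### Assembly of the three claims -/

theorem proposition3p1
    {Ω : Type*} [MeasurableSpace Ω] (μ : Measure Ω) [IsProbabilityMeasure μ]
    -- sample sizes and fixed numbers of factors
    (N T : ℕ → ℕ) (hN : Tendsto N atTop atTop) (hT : Tendsto T atTop atTop)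
    (K₁ K₂ : ℕ) (hK₁ : 0 < K₁) (hK₂ : 0 < K₂)
    -- deterministic loadings, random factors, regressors and errors
    (Λ : ∀ n, Matrix (Fin (N n)) (Fin K₁) ℝ) (A : ∀ n, Matrix (Fin (N n)) (Fin K₂) ℝ)
    (F : ∀ n, Ω → Matrix (Fin (T n)) (Fin K₁) ℝ) (G : ∀ n, Ω → Matrix (Fin (T n)) (Fin K₂) ℝ)
    (X U : ∀ n, Ω → Matrix (Fin (N n)) (Fin (T n)) ℝ)
    -- the (possibly random) split of the periods other than `t`
    (t : ∀ n, Fin (T n)) (I : ∀ n, Ω → Finset (Fin (T n)))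
    (htI : ∀ n ω, t n ∉ I n ω) (hI : ∀ n ω, (I n ω).card = (T n - 1) / 2)
    -- tuning parameters: positive, of the same order, and dominating the scores
    (ν₁ ν₂ : ℕ → Ω → ℝ) (hν₁ : ∀ n ω, 0 < ν₁ n ω) (hν₂ : ∀ n ω, 0 < ν₂ n ω)
    (c ρ : ℝ) (hc : 0 < c) (hc1 : c < 1)
    (hρ : WithProbTendingToOne μ
      (fun n ω => ν₁ n ω ≤ ρ * ν₂ n ω ∧ ν₂ n ω ≤ ρ * ν₁ n ω))
    (hXU : WithProbTendingToOne μ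
      (fun n ω => 2 * opNorm (X n ω ⊙ U n ω) < (1 - c) * ν₁ n ω))
    (hU : WithProbTendingToOne μ (fun n ω => 2 * opNorm (U n ω) < (1 - c) * ν₂ n ω))
    -- restricted strong convexity, on the two subsamples and on the full sample
    (a κ : ℝ) (ha : ρ * (2 - c) / c ≤ a) (hκ : 0 < κ)
    (hRSC : ∀ s : SampleKind, WithProbTendingToOne μ (fun n ω =>
      RestrictedStrongConvexity (onSample (X n ω) (s.periods (t n) (I n ω)))
        (onSample (A n * (G n ω)ᵀ) (s.periods (t n) (I n ω)))
        (onSample (Λ n * (F n ω)ᵀ) (s.periods (t n) (I n ω))) a κ))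
    -- the nuclear norm estimators on each sample
    (Mt Tht : ∀ n ω (s : SampleKind), Matrix (Fin (N n)) (s.periods (t n) (I n ω)) ℝ)
    (hest : ∀ n ω s, IsNuclearNormEstimator
      (onSample (outcome (Λ n) (F n ω) (A n) (G n ω) (X n ω) (U n ω)) (s.periods (t n) (I n ω)))
      (onSample (X n ω) (s.periods (t n) (I n ω))) (ν₁ n ω) (ν₂ n ω) (Mt n ω s) (Tht n ω s))
    -- the rank estimators, from the full sample
    (Kh₁ Kh₂ : ℕ → Ω → ℕ)
    (hKh₁ : ∀ n ω, Kh₁ n ω = rankEstimate (ν₂ n ω) (Tht n ω .full))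
    (hKh₂ : ∀ n ω, Kh₂ n ω = rankEstimate (ν₁ n ω) (Mt n ω .full))
    -- the estimated loadings on each sample
    (Λt : ∀ n ω (_ : SampleKind), Matrix (Fin (N n)) (Fin (Kh₁ n ω)) ℝ)
    (At : ∀ n ω (_ : SampleKind), Matrix (Fin (N n)) (Fin (Kh₂ n ω)) ℝ)
    (hΛt : ∀ n ω s, IsLoadingEstimator (Tht n ω s) (Λt n ω s))
    (hAt : ∀ n ω s, IsLoadingEstimator (Mt n ω s) (At n ω s)) :
    -- (i)
    (∀ s : SampleKind,
      IsBigOP μ (fun n ω => ENNReal.ofReal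
          (frobSq (Mt n ω s - onSample (A n * (G n ω)ᵀ) (s.periods (t n) (I n ω)))
            / (N n * T n)))
        (fun n ω => ((ν₂ n ω) ^ 2 + (ν₁ n ω) ^ 2) / (N n * T n)) ∧
      IsBigOP μ (fun n ω => ENNReal.ofReal
          (frobSq (Tht n ω s - onSample (Λ n * (F n ω)ᵀ) (s.periods (t n) (I n ω)))
            / (N n * T n)))
        (fun n ω => ((ν₂ n ω) ^ 2 + (ν₁ n ω) ^ 2) / (N n * T n))) ∧
    (StrongDistinctFactors μ Λ F → StrongDistinctFactors μ A G →
      BalancedFactors μ F t I → BalancedFactors μ G t I →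
      IsLittleOPOne μ (fun n ω => ((ν₂ n ω) ^ 2 + (ν₁ n ω) ^ 2) / (N n * T n)) →
      -- (ii)
      (∀ s : SampleKind,
        ∃ (H₁ : ℕ → Ω → Matrix (Fin K₂) (Fin K₂) ℝ) (H₂ : ℕ → Ω → Matrix (Fin K₁) (Fin K₁) ℝ),
          IsBigOP μ (fun n ω => loadingError (At n ω s) (A n) (H₁ n ω))
            (fun n ω => ((ν₂ n ω) ^ 2 + (ν₁ n ω) ^ 2) / (N n * T n)) ∧
          IsBigOP μ (fun n ω => loadingError (Λt n ω s) (Λ n) (H₂ n ω))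
            (fun n ω => ((ν₂ n ω) ^ 2 + (ν₁ n ω) ^ 2) / (N n * T n)) ∧
          WithProbTendingToOne μ (fun n ω => IsUnit (H₁ n ω) ∧ IsUnit (H₂ n ω))) ∧
      -- (iii)
      WithProbTendingToOne μ (fun n ω => Kh₁ n ω = K₁ ∧ Kh₂ n ω = K₂)) := by
  -- Singular values are counted from zero, so the last factor corresponds to `sval _ k₁`.
  obtain ⟨k₁, rfl⟩ : ∃ k, K₁ = k + 1 := ⟨K₁ - 1, by omega⟩
  obtain ⟨k₂, rfl⟩ : ∃ k, K₂ = k + 1 := ⟨K₂ - 1, by omega⟩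
  set k := max (k₁ + 1) (k₂ + 1) with hk
  set C : ℝ := 16 * k / κ ^ 2 with hCdef
  have hkpos : 0 < k := lt_max_of_lt_left (Nat.succ_pos _)
  have hC : 0 < C := by positivity
  set V : ℕ → Ω → ℝ := fun n ω => ν₂ n ω ^ 2 + ν₁ n ω ^ 2 with hV
  rw [withProbTendingToOne_iff] at hρ hXU hU
  have hrate : ∀ s : SampleKind, ∀ᶠ x in probFilter μ,
      frobSq (Mt x.1 x.2 s -
          onSample (A x.1 * (G x.1 x.2)ᵀ) (s.periods (t x.1) (I x.1 x.2))) +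
        frobSq (Tht x.1 x.2 s -
          onSample (Λ x.1 * (F x.1 x.2)ᵀ) (s.periods (t x.1) (I x.1 x.2))) ≤
        C * V x.1 x.2 := by
    intro s
    filter_upwards [hρ, hXU, hU, withProbTendingToOne_iff.1 (hRSC s)] with x h1 h2 h3 h4
    have hX := opNorm_onSample_le (X x.1 x.2 ⊙ U x.1 x.2) (s.periods (t x.1) (I x.1 x.2))
    have hU' := opNorm_onSample_le (U x.1 x.2) (s.periods (t x.1) (I x.1 x.2))
    exact frobSq_estimator_le (E := onSample (U x.1 x.2) _) (hν₁ _ _) (hν₂ _ _) hc hc1 h1.1 h1.2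
      ((mul_le_mul_of_nonneg_left hX zero_le_two).trans h2.le) (by linarith) ha hκ h4
      ((rank_onSample_mul_le _ _ _).trans (le_max_right _ _))
      ((rank_onSample_mul_le _ _ _).trans (le_max_left _ _)) (hest x.1 x.2 s)
  have hrateM : ∀ s : SampleKind, ∀ᶠ x in probFilter μ,
      frobSq (Mt x.1 x.2 s -
        onSample (A x.1 * (G x.1 x.2)ᵀ) (s.periods (t x.1) (I x.1 x.2))) ≤ C * V x.1 x.2 :=
    fun s => (hrate s).mono fun x hx => le_trans (le_add_of_nonneg_right (frobSq_nonneg _)) hx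
  have hrateTh : ∀ s : SampleKind, ∀ᶠ x in probFilter μ,
      frobSq (Tht x.1 x.2 s -
        onSample (Λ x.1 * (F x.1 x.2)ᵀ) (s.periods (t x.1) (I x.1 x.2))) ≤ C * V x.1 x.2 :=
    fun s => (hrate s).mono fun x hx => le_trans (le_add_of_nonneg_left (frobSq_nonneg _)) hx
  have hscale : ∀ (n : ℕ) {y v : ℝ}, y ≤ C * v →
      ENNReal.ofReal (y / (N n * T n)) ≤ ENNReal.ofReal (C * (v / (N n * T n))) := by
    intro n y v h
    refine ENNReal.ofReal_le_ofReal ?_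
    rw [← mul_div_assoc]
    exact div_le_div_of_nonneg_right h (by positivity)
  refine ⟨fun s => ⟨IsBigOP.of_eventually_le hC ((hrateM s).mono fun x hx => hscale x.1 hx),
    IsBigOP.of_eventually_le hC ((hrateTh s).mono fun x hx => hscale x.1 hx)⟩, ?_⟩
  intro hsF hsG hbF hbG hsmall
  -- Comparability of the penalties gives `V ≤ (ρ² + 1) ν²` for either penalty `ν`.
  have hD : (0 : ℝ) < ρ ^ 2 + 1 := by positivity
  have hsq : ∀ {p q : ℝ}, 0 < p → p ≤ ρ * q → p ^ 2 ≤ ρ ^ 2 * q ^ 2 := fun hp h => by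
    rw [← mul_pow]
    exact pow_le_pow_left₀ hp.le h 2
  obtain ⟨⟨CF, hCF, hF⟩, hrF⟩ := factor_recovery hN hT Λ F t I htI hI hν₂ hC hD
    (Eventually.of_forall fun x => le_add_of_nonneg_right (sq_nonneg _))
    (hρ.mono fun x hx => by
      have := hsq (hν₁ x.1 x.2) hx.1
      simp only [hV]
      linarith) Tht hrateTh hsF hbF hsmall
  obtain ⟨⟨CG, hCG, hG⟩, hrG⟩ := factor_recovery hN hT A G t I htI hI hν₁ hC hD
    (Eventually.of_forall fun x => le_add_of_nonneg_left (sq_nonneg _))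
    (hρ.mono fun x hx => by
      have := hsq (hν₂ x.1 x.2) hx.2
      simp only [hV]
      linarith) Mt hrateM hsG hbG hsmall
  simp only [← hKh₁] at hrF
  simp only [← hKh₂] at hrG
  refine ⟨fun s => ?_, hrF.and hrG⟩
  obtain ⟨H₁, hH₁, hu₁⟩ := exists_rotation_sequence (Lt := fun n ω => At n ω s)
    (r := fun n ω => V n ω / (N n * T n)) hCG
    (by filter_upwards [hG s, hrG] with x h1 h2 using exists_loadingError_le h1 h2 (hAt x.1 x.2 s))
  obtain ⟨H₂, hH₂, hu₂⟩ := exists_rotation_sequence (Lt := fun n ω => Λt n ω s)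
    (r := fun n ω => V n ω / (N n * T n)) hCF
    (by filter_upwards [hF s, hrF] with x h1 h2 using exists_loadingError_le h1 h2 (hΛt x.1 x.2 s))
  exact ⟨H₁, H₂, hH₁, hH₂, hu₁.and hu₂⟩
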